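/- **Model.** An $n\times n$ input-queued switch in discrete time has queue lengths $q(t)=(q_{ij}(t))\in\mathbb Z_+^{n\times n}$. In slot $t$ a feasible schedule $s(t)$ is chosen ($s_{ij}\in\{0,1\}$, all row and column sums at most $1$), then arrivals $a(t)\in\mathbb Z_+^{n\times n}$ occur, and $q_{ij}(t+1)=[q_{ij}(t)+a_{ij}(t)-s_{ij}(t)]^+$. The arrivals are i.i.d. in $t$, independent over the pairs $(i,j)$, and $a(t)$ is independent of the past and of the schedules up to slot $t$. The MaxWeight algorithm chooses, as a (possibly randomized) function of $q(t)$, a perfect matching $s$ maximizing $\sum_{ij}q_{ij}s_{ij}$ over all feasible schedules, with ties broken arbitrarily. The capacity region is $\mathcal C=\{x\in\mathbb R_+^{n\times n}:\sum_j x_{ij}\le 1\ \forall i,\ \sum_i x_{ij}\le 1\ \forall j\}$. Write $\langle x,y\rangle=\sum_{ij}x_{ij}y_{ij}$. **Setting.** Let $0\le n_1,n_2<n$, and let $\nu$ with $\min_{ij}\nu_{ij}>0$ lie in the relative interior of the face $\{x\in\mathcal C:\sum_j x_{ij}=1\ (i\le n_1),\ \sum_i x_{ij}=1\ (j\le n_2)\}$.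 Let $k\in\mathbb R_+^{n\times n}$ with $\sum_{ij}k_{ij}=n$, and put $\kappa_i=\sum_j k_{ij}$, $\tilde\kappa_j=\sum_i k_{ij}$; assume $\kappa_i>0$ for $i\le n_1$ and $\tilde\kappa_j>0$ for $j\le n_2$. For some $\varepsilon_0>0$ and each $0<\varepsilon<\varepsilon_0$, let the arrivals $a^{(\varepsilon)}$ be bounded by $a_{\max}$ (independent of $\varepsilon$), with mean $\nu-\varepsilon k$ and variances $(\sigma^{(\varepsilon)}_{ij})^2\to\sigma_{ij}^2$ as $\varepsilon\downarrow0$; write $\sigma^2=(\sigma_{ij}^2)_{ij}$. Let $$\zeta_{ij}=\begin{cases}2-\frac{2n-n_1-n_2}{n^2-n_1n_2}& i\le n_1,\ j\le n_2\\ 1+\frac{n_2}{n^2-n_1n_2}& i\le n_1,\ j>n_2\\ 1+\frac{n_1}{n^2-n_1n_2}& i>n_1,\ j\le n_2\\ 0& i>n_1,\ j>n_2,\end{cases}$$ let $\kappa_{\max}$ and $\kappa_{\min}$ be the maximum and the minimum of the numbers $\kappa_i$ $(i\le n_1)$ and $\tilde\kappa_j$ $(j\le n_2)$, and let $\zeta'_{ij}=1/\kappa_i$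 if $i\le n_1$ and $\zeta'_{ij}=0$ otherwise, $\zeta''_{ij}=1/\tilde\kappa_j$ if $j\le n_2$ and $\zeta''_{ij}=0$ otherwise. **Claim.** (1) Under MaxWeight, for each $0<\varepsilon<\varepsilon_0$ the queue length Markov chain has exactly one stationary distribution, and if $\bar q^{(\varepsilon)}$ has this distribution, then $$\frac{\langle\sigma^2,\zeta\rangle}{2\kappa_{\max}}\le\liminf_{\varepsilon\downarrow0}\varepsilon\,\mathbb E\Big[\sum_{ij}\bar q^{(\varepsilon)}_{ij}\Big]\le\limsup_{\varepsilon\downarrow0}\varepsilon\,\mathbb E\Big[\sum_{ij}\bar q^{(\varepsilon)}_{ij}\Big]\le\frac{\langle\sigma^2,\zeta\rangle}{2\kappa_{\min}}.$$ (If $n_1=n_2=0$, then $\zeta=0$ and both bounds are read as $0$.) (2) Suppose that for each $0<\varepsilon<\varepsilon_0$ the switch is operated under any non-anticipating scheduling policy (the schedule may depend on the whole past and on extra randomness) under which it is stable, in the sense that $q^{(\varepsilon)}(t)$ converges in distribution as $t\to\infty$ to a (finite) random vector $\bar q^{(\varepsilon)}$. Then $$\liminf_{\varepsilon\downarrow0}\varepsilon\,\mathbb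 E\Big[\sum_{ij}\bar q^{(\varepsilon)}_{ij}\Big]\ge\tfrac12\max\{\langle\sigma^2,\zeta'\rangle,\langle\sigma^2,\zeta''\rangle\},$$ where the expectation may be $+\infty$. -/

import Mathlib

open Filter Topology MeasureTheory ProbabilityTheory
open scoped ENNReal

namespace Switch

/-- Queue lengths, arrivals and schedules of an `n × n` switch: natural numbers indexed by
(input port, output port). -/
abbrev Config (n : ℕ) : Type := Fin n → Fin n → ℕ

/-- Real `n × n` arrays, regarded as vectors of `ℝ^{n²}`. -/
abbrev RVec (n : ℕ) : Type := Fin n → Fin n → ℝ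

/-- The scalar product of `ℝ^{n²}`. -/
def dot {n : ℕ} (x y : RVec n) : ℝ := ∑ i, ∑ j, x i j * y i j

/-- Sum of row `i` (input port `i`). -/
def rowSum {n : ℕ} (x : RVec n) (i : Fin n) : ℝ := ∑ j, x i j

/-- Sum of column `j` (output port `j`). -/
def colSum {n : ℕ} (x : RVec n) (j : Fin n) : ℝ := ∑ i, x i j

/-- The capacity region of the switch. -/
def capacityRegion (n : ℕ) : Set (RVec n) :=
  {x | (∀ i j, 0 ≤ x i j) ∧ (∀ i, rowSum x i ≤ 1) ∧ ∀ j, colSum x j ≤ 1}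

/-- The face of the capacity region on which the first `n₁` input ports and the first `n₂`
output ports are saturated. -/
def face (n n₁ n₂ : ℕ) : Set (RVec n) :=
  {x | x ∈ capacityRegion n ∧ (∀ i : Fin n, (i : ℕ) < n₁ → rowSum x i = 1) ∧
    ∀ j : Fin n, (j : ℕ) < n₂ → colSum x j = 1}

/-- The saturation rates `κ i`, `κ̃ j` of the saturated input and output ports. -/
def saturationRates {n : ℕ} (n₁ n₂ : ℕ) (k : RVec n) : Set ℝ :=
  {x | (∃ i : Fin n, (i : ℕ) < n₁ ∧ x = rowSum k i) ∨
    ∃ j : Fin n, (j : ℕ) < n₂ ∧ x = colSum k j}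

/-- The largest saturation rate of a saturated port (`0` if no port is saturated). -/
noncomputable def kappaMax {n : ℕ} (n₁ n₂ : ℕ) (k : RVec n) : ℝ :=
  sSup (saturationRates n₁ n₂ k)

/-- The smallest saturation rate of a saturated port (`0` if no port is saturated). -/
noncomputable def kappaMin {n : ℕ} (n₁ n₂ : ℕ) (k : RVec n) : ℝ :=
  sInf (saturationRates n₁ n₂ k)

/-- The vector `ζ`. -/
noncomputable def zeta (n n₁ n₂ : ℕ) : RVec n := fun i j =>
  if (i : ℕ) < n₁ then
    if (j : ℕ) < n₂ then 2 - (2 * (n : ℝ) - n₁ - n₂) / ((n : ℝ) ^ 2 - n₁ * n₂)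
    else 1 + (n₂ : ℝ) / ((n : ℝ) ^ 2 - n₁ * n₂)
  else
    if (j : ℕ) < n₂ then 1 + (n₁ : ℝ) / ((n : ℝ) ^ 2 - n₁ * n₂)
    else 0

/-- The vector `ζ'`: `1 / κ i` in the rows of saturated input ports, `0` elsewhere. -/
noncomputable def zetaRow {n : ℕ} (n₁ : ℕ) (k : RVec n) : RVec n := fun i _ =>
  if (i : ℕ) < n₁ then 1 / rowSum k i else 0

/-- The vector `ζ''`: `1 / κ̃ j` in the columns of saturated output ports, `0` elsewhere. -/
noncomputable def zetaCol {n : ℕ} (n₂ : ℕ) (k : RVec n) : RVec n := fun _ j =>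
  if (j : ℕ) < n₂ then 1 / colSum k j else 0

/-- The feasible schedules: (partial) matchings of input ports with output ports. -/
def feasibleSchedules (n : ℕ) : Set (Config n) :=
  {s | (∀ i, ∑ j, s i j ≤ 1) ∧ ∀ j, ∑ i, s i j ≤ 1}

/-- The maximal feasible schedules: perfect matchings. -/
def maximalSchedules (n : ℕ) : Set (Config n) :=
  {s | (∀ i, ∑ j, s i j = 1) ∧ ∀ j, ∑ i, s i j = 1}

/-- The weight of schedule `s` when the queue lengths are `q`. -/
def weight {n : ℕ} (q s : Config n) : ℕ := ∑ i, ∑ j, q i j * s i j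

/-- The queue lengths `[q + a - s]⁺` after one time slot. Subtraction of natural numbers is
truncated at `0`, which is the positive part. -/
def nextQueue {n : ℕ} (q a s : Config n) : Config n := fun i j => q i j + a i j - s i j

/-- The law of the arrivals of one time slot: independent over the pairs `(i, j)`, with marginal
laws `A i j`. -/
noncomputable def arrivalLaw {n : ℕ} (A : Fin n → Fin n → PMF ℕ) : Measure (Config n) :=
  Measure.pi fun i => Measure.pi fun j => (A i j).toMeasure

/-- A (stationary, possibly randomized) scheduling rule: the law of the schedule as a function of
the current queue lengths. -/
abbrev Policy (n : ℕ) : Type := Config n → PMF (Config n)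

/-- `pol` is a MaxWeight rule: it always chooses a maximal schedule whose weight is the largest
among all feasible schedules. Ties may be broken in any way, deterministic or random. -/
def Policy.IsMaxWeight {n : ℕ} (pol : Policy n) : Prop :=
  ∀ q, ∀ s ∈ (pol q).support,
    s ∈ maximalSchedules n ∧ ∀ s' ∈ feasibleSchedules n, weight q s' ≤ weight q s

/-- The transition kernel of the queue length Markov chain: given the queue lengths, the schedule
is drawn according to the scheduling rule and the arrivals are independent of it. -/
noncomputable def queueKernel {n : ℕ} (A : Fin n → Fin n → PMF ℕ) (pol : Policy n) :
    Kernel (Config n) (Config n) :=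
  Kernel.ofFunOfCountable fun q =>
    ((pol q).toMeasure.prod (arrivalLaw A)).map fun p => nextQueue q p.2 p.1

/-- `π` is a steady-state (stationary) distribution of the chain with kernel `K`. -/
def IsSteadyState {n : ℕ} (K : Kernel (Config n) (Config n)) (π : Measure (Config n)) : Prop :=
  IsProbabilityMeasure π ∧ K.Invariant π

/-- The expectation, possibly `∞`, of the total queue length under the law `π`. -/
noncomputable def meanTotal {n : ℕ} (π : Measure (Config n)) : ℝ≥0∞ :=
  ∫⁻ q, ((∑ i, ∑ j, q i j : ℕ) : ℝ≥0∞) ∂π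

/-- The switch run by an arbitrary non-anticipating scheduling policy. The queue lengths `q t`
and the feasible schedule `s t` are known at the beginning of slot `t` (the schedule may depend
on the whole past and on extra randomness); the arrivals `a t` are then drawn from the arrival
law, independently of the past and of the schedule. -/
structure IsSwitchProcess {n : ℕ} {Ω : Type*} [mΩ : MeasurableSpace Ω] (P : Measure Ω)
    (A : Fin n → Fin n → PMF ℕ) (ℱ : Filtration ℕ mΩ) (a s q : ℕ → Ω → Config n) : Prop where
  arrivals_meas : ∀ t, Measurable[ℱ (t + 1)] (a t)
  schedule_meas : ∀ t, Measurable[ℱ t] (s t)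
  queue_meas : ∀ t, Measurable[ℱ t] (q t)
  arrivals_law : ∀ t, P.map (a t) = arrivalLaw A
  arrivals_indep : ∀ t, Indep (MeasurableSpace.comap (a t) inferInstance) (ℱ t) P
  schedule_mem : ∀ t ω, s t ω ∈ feasibleSchedules n
  evolve : ∀ t ω, q (t + 1) ω = nextQueue (q t ω) (a t ω) (s t ω)

end Switch

/-!
Call the rows `i < n₁` and the columns `j < n₂` saturated. Under MaxWeight the service capacity left
over by `ν` can be spent in every direction of the polar cone of the indicators of the saturated
rows and columns. Hence the distance from the queue vector to the cone generated by these
indicators has negative drift where it is large, and its second moment stays bounded as `ε → 0`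
(state space collapse).

Let `P` be the orthogonal projection onto the span of these indicators. In the steady state the
expected increment of `‖P q‖²` is zero. Perfect matchings have the same saturated row and column
sums as `ν`, so this identity says that `2 ε E⟪P q, k⟫` is the variance of the projected arrivals up
to terms due to unused service. A queue with unused service is empty, so only the bounded distance
from `q` to the span enters these terms, multiplied by the square root of the `O(ε)` amount of
unused service in the saturated rows and columns; they tend to zero. On the cone `⟪q, k⟫` lies
between `κ_min / n` and `κ_max / n` times the total queue length, which gives the two bounds, since
the diagonal of the matrix of `P` is `ζ / n`.

Under an arbitrary policy a saturated row or column has at least the total queue length of a single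
queue with unit service and the same arrivals. Kingman's bound for that queue, summed over the rows
or over the columns, gives the last inequality.
-/

open scoped RealInnerProductSpace

namespace Switch

variable {n : ℕ}

section Polar

variable {F : Type*} [NormedAddCommGroup F] [InnerProductSpace ℝ F] [CompleteSpace F]

/-- The polar cone of `s`: the vectors having a nonpositive inner product with all elements
of `s`. -/
noncomputable def polarCone (s : Set F) : ProperCone ℝ F := ProperCone.innerDual (-s)

lemma mem_polarCone {s : Set F} {y : F} : y ∈ polarCone s ↔ ∀ x ∈ s, ⟪x, y⟫ ≤ 0 := by
  simp only [polarCone, ProperCone.mem_innerDual]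
  refine ⟨fun h x hx => ?_, fun h x hx => ?_⟩
  · simpa using h (x := -x) (by simpa using hx)
  · simpa using h (-x) hx

lemma exists_mem_properCone_inner_le (C : ProperCone ℝ F) (x : F) :
    ∃ p ∈ C, ⟪x - p, p⟫ = 0 ∧ ∀ y ∈ C, ⟪x - p, y⟫ ≤ 0 := by
  have hconv : Convex ℝ (C : Set F) := C.convex
  obtain ⟨p, hp, hmin⟩ :=
    exists_norm_eq_iInf_of_complete_convex C.nonempty C.isClosed.isComplete hconv x
  rw [norm_eq_iInf_iff_real_inner_le_zero hconv hp] at hmin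
  have hzero : ⟪x - p, p⟫ = 0 := by
    have h₀ := hmin 0 C.zero_mem
    have h₂ := hmin (p + p) (C.add_mem hp hp)
    rw [zero_sub, inner_neg_right] at h₀
    rw [add_sub_cancel_right] at h₂
    linarith
  refine ⟨p, hp, hzero, fun y hy => ?_⟩
  simpa only [inner_sub_right, hzero, sub_zero] using hmin y hy

/-- The component of `x` in the polar cone of `s` in the Moreau decomposition of `x`, that is, the
metric projection of `x` onto the polar cone. Its norm is the distance from `x` to the closed
convex cone generated by `s`. -/
noncomputable def polarPart (s : Set F) (x : F) : F :=
  (exists_mem_properCone_inner_le (polarCone s) x).choose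

/-- The component of `x` in the closed convex cone generated by `s` in the Moreau decomposition
of `x`. -/
noncomputable def conePart (s : Set F) (x : F) : F := x - polarPart s x

variable (s : Set F) (x : F)

lemma polarPart_mem : polarPart s x ∈ polarCone s :=
  (exists_mem_properCone_inner_le (polarCone s) x).choose_spec.1

lemma inner_conePart_polarPart : ⟪conePart s x, polarPart s x⟫ = 0 :=
  (exists_mem_properCone_inner_le (polarCone s) x).choose_spec.2.1

lemma conePart_add_polarPart : conePart s x + polarPart s x = x := sub_add_cancel _ _

variable {s}

lemma inner_conePart_nonpos {y : F} (hy : y ∈ polarCone s) : ⟪conePart s x, y⟫ ≤ 0 :=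
  (exists_mem_properCone_inner_le (polarCone s) x).choose_spec.2.2 y hy

lemma inner_conePart_eq_zero {y : F} (hy : ∀ v ∈ s, ⟪v, y⟫ = 0) : ⟪conePart s x, y⟫ = 0 := by
  have hneg := inner_conePart_nonpos (y := -y) x
    (mem_polarCone.2 fun v hv => by rw [inner_neg_right, hy v hv, neg_zero])
  rw [inner_neg_right, neg_nonpos] at hneg
  exact (inner_conePart_nonpos x (mem_polarCone.2 fun v hv => (hy v hv).le)).antisymm hneg

variable (s)

lemma inner_polarPart_self : ⟪x, polarPart s x⟫ = ‖polarPart s x‖ ^ 2 := by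
  have h := inner_conePart_polarPart s x
  rw [conePart, inner_sub_left, real_inner_self_eq_norm_sq] at h
  linarith

lemma polarPart_empty : polarPart ∅ x = x := by
  have h := inner_conePart_nonpos x (s := ∅) (y := conePart ∅ x) (mem_polarCone.2 (by simp))
  rw [real_inner_self_nonpos, conePart, sub_eq_zero] at h
  exact h.symm

lemma norm_polarPart_le_norm_sub_conePart (y : F) :
    ‖polarPart s y‖ ≤ ‖y - conePart s x‖ := by
  rcases (norm_nonneg (polarPart s y)).eq_or_lt with h | h
  · exact h ▸ norm_nonneg _
  refine le_of_mul_le_mul_right ?_ h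
  calc ‖polarPart s y‖ * ‖polarPart s y‖
      = ⟪y, polarPart s y⟫ := by rw [inner_polarPart_self, sq]
    _ ≤ ⟪y - conePart s x, polarPart s y⟫ := by
        rw [inner_sub_left]
        linarith [inner_conePart_nonpos x (polarPart_mem s y)]
    _ ≤ ‖y - conePart s x‖ * ‖polarPart s y‖ := real_inner_le_norm _ _

lemma norm_polarPart_add_le (d : F) : ‖polarPart s (x + d)‖ ≤ ‖polarPart s x + d‖ := by
  have h := norm_polarPart_le_norm_sub_conePart s x (x + d)
  rwa [conePart, show x + d - (x - polarPart s x) = polarPart s x + d by abel] at h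

lemma abs_norm_polarPart_add_sub_le (d : F) :
    |‖polarPart s (x + d)‖ - ‖polarPart s x‖| ≤ ‖d‖ := by
  have h₁ := (norm_polarPart_add_le s x d).trans (norm_add_le _ _)
  have h₂ := (norm_polarPart_add_le s (x + d) (-d)).trans (norm_add_le _ _)
  rw [norm_neg, add_neg_cancel_right] at h₂
  exact abs_le.2 ⟨by linarith, by linarith⟩

lemma norm_polarPart_le : ‖polarPart s x‖ ≤ ‖x‖ := by
  have hzero : ‖polarPart s (0 : F)‖ = 0 := by
    have h := inner_polarPart_self s (0 : F)
    rwa [inner_zero_left, eq_comm, sq_eq_zero_iff] at h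
  have h := abs_norm_polarPart_add_sub_le s 0 x
  rw [zero_add, hzero, sub_zero] at h
  exact (le_abs_self _).trans h

variable [(Submodule.span ℝ s).HasOrthogonalProjection]

lemma conePart_mem_span : conePart s x ∈ Submodule.span ℝ s := by
  rw [← (Submodule.span ℝ s).orthogonal_orthogonal, Submodule.mem_orthogonal']
  exact fun y hy => inner_conePart_eq_zero x fun v hv =>
    (Submodule.mem_orthogonal _ y).1 hy v (Submodule.subset_span hv)

lemma norm_sub_starProjection_span_le :
    ‖x - (Submodule.span ℝ s).starProjection x‖ ≤ ‖polarPart s x‖ := by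
  rw [Submodule.starProjection_minimal]
  exact ciInf_le_of_le ⟨0, by rintro _ ⟨_, rfl⟩; positivity⟩ ⟨_, conePart_mem_span s x⟩
    (by simp only [conePart, sub_sub_cancel, le_refl])

lemma norm_starProjection_span_sub_conePart_le :
    ‖(Submodule.span ℝ s).starProjection x - conePart s x‖ ≤ ‖polarPart s x‖ := by
  have h : (Submodule.span ℝ s).starProjection (conePart s x) = conePart s x :=
    Submodule.starProjection_eq_self_iff.2 (conePart_mem_span s x)
  rw [← h, ← map_sub, conePart, sub_sub_cancel]
  exact Submodule.norm_starProjection_apply_le _ _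

end Polar

section Vectors

/-- `ℝ^{n²}` as a Euclidean space. -/
abbrev Vec (n : ℕ) : Type := EuclideanSpace ℝ (Fin n × Fin n)

/-- The identification of real arrays with vectors of the Euclidean space `ℝ^{n²}`. -/
def vec : RVec n ≃ₗ[ℝ] Vec n :=
  (LinearEquiv.curry ℝ ℝ (Fin n) (Fin n)).symm ≪≫ₗ (WithLp.linearEquiv 2 ℝ _).symm

/-- A configuration as a vector of the Euclidean space `ℝ^{n²}`. -/
def natVec (q : Config n) : Vec n := vec fun i j => (q i j : ℝ)

lemma vec_apply (x : RVec n) (e : Fin n × Fin n) : vec x e = x e.1 e.2 := rfl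

lemma natVec_apply (q : Config n) (e : Fin n × Fin n) : natVec q e = q e.1 e.2 := rfl

lemma inner_eq_sum (x y : Vec n) : ⟪x, y⟫ = ∑ i, ∑ j, x (i, j) * y (i, j) := by
  rw [PiLp.inner_apply, Fintype.sum_prod_type]
  exact Finset.sum_congr rfl fun i _ => Finset.sum_congr rfl fun j _ => mul_comm _ _

lemma inner_natVec_natVec (q s : Config n) : ⟪natVec q, natVec s⟫ = weight q s := by
  rw [inner_eq_sum, weight]
  push_cast
  rfl

lemma norm_le_of_abs_apply_le {x : Vec n} {c : ℝ} (hc : 0 ≤ c) (h : ∀ e, |x e| ≤ c) :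
    ‖x‖ ≤ n * c := by
  refine abs_le_of_sq_le_sq' ?_ (by positivity) |>.2
  rw [EuclideanSpace.norm_sq_eq]
  calc ∑ e, ‖x e‖ ^ 2 ≤ ∑ _e : Fin n × Fin n, c ^ 2 := by gcongr with e; exact h e
    _ = (n * c) ^ 2 := by simp; ring

end Vectors

section Ports

/-- The ports of the switch: the input ports `Sum.inl i` and the output ports `Sum.inr j`. -/
abbrev Port (n : ℕ) : Type := Fin n ⊕ Fin n

/-- The indicator of the row (input port) or column (output port) `p`. The number of packets of
`q` at port `p` is `weight (portConfig p) q`. -/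
def portConfig : Port n → Config n
  | .inl i => fun i' _ => if i' = i then 1 else 0
  | .inr j => fun _ j' => if j' = j then 1 else 0

/-- The row sum or column sum of `x` belonging to the port `p`. -/
def portSum (x : RVec n) (p : Port n) : ℝ := Sum.elim (rowSum x) (colSum x) p

/-- The indicator of the row or column `p` as a vector. -/
def portVec (p : Port n) : Vec n := natVec (portConfig p)

/-- The set formed by the first `n₁` input ports and the first `n₂` output ports. -/
def saturated (n n₁ n₂ : ℕ) : Set (Port n) :=
  {p | Sum.elim (fun i : Fin n => (i : ℕ) < n₁) (fun j : Fin n => (j : ℕ) < n₂) p}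

@[simp]
lemma inl_mem_saturated {n₁ n₂ : ℕ} {i : Fin n} :
    Sum.inl i ∈ saturated n n₁ n₂ ↔ (i : ℕ) < n₁ := Iff.rfl

@[simp]
lemma inr_mem_saturated {n₁ n₂ : ℕ} {j : Fin n} :
    Sum.inr j ∈ saturated n n₁ n₂ ↔ (j : ℕ) < n₂ := Iff.rfl

lemma inner_portVec_vec (p : Port n) (x : RVec n) : ⟪portVec p, vec x⟫ = portSum x p := by
  rw [inner_eq_sum]
  rcases p with i | j <;>
    simp [portVec, natVec_apply, portConfig, vec_apply, portSum, rowSum, colSum]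

lemma portSum_sub (x y : RVec n) (p : Port n) :
    portSum (x - y) p = portSum x p - portSum y p := by
  simp only [← inner_portVec_vec, map_sub, inner_sub_right]

lemma portSum_add_smul (x y : RVec n) (t : ℝ) (p : Port n) :
    portSum (x + t • y) p = portSum x p + t * portSum y p := by
  simp only [← inner_portVec_vec, map_add, map_smul, inner_add_right, real_inner_smul_right]

lemma portSum_smul (t : ℝ) (x : RVec n) (p : Port n) : portSum (t • x) p = t * portSum x p := by
  rw [← inner_portVec_vec, map_smul, real_inner_smul_right, inner_portVec_vec]

lemma portSum_nonneg {x : RVec n} (hx : ∀ i j, 0 ≤ x i j) (p : Port n) : 0 ≤ portSum x p := by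
  rcases p with i | j <;> simp only [portSum, Sum.elim_inl, Sum.elim_inr]
  · exact Finset.sum_nonneg fun j _ => hx i j
  · exact Finset.sum_nonneg fun i _ => hx i j

lemma inner_portVec_natVec (p : Port n) (q : Config n) :
    ⟪portVec p, natVec q⟫ = weight (portConfig p) q := inner_natVec_natVec _ _

lemma weight_portConfig_inl (i : Fin n) (s : Config n) :
    weight (portConfig (.inl i)) s = ∑ j, s i j := by
  simp [weight, portConfig]

lemma weight_portConfig_inr (j : Fin n) (s : Config n) :
    weight (portConfig (.inr j)) s = ∑ i, s i j := by
  simp [weight, portConfig]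

lemma mem_feasibleSchedules_iff {s : Config n} :
    s ∈ feasibleSchedules n ↔ ∀ p, weight (portConfig p) s ≤ 1 := by
  simp only [Sum.forall, weight_portConfig_inl, weight_portConfig_inr]
  rfl

lemma mem_maximalSchedules_iff {s : Config n} :
    s ∈ maximalSchedules n ↔ ∀ p, weight (portConfig p) s = 1 := by
  simp only [Sum.forall, weight_portConfig_inl, weight_portConfig_inr]
  rfl

lemma maximalSchedules_subset_feasibleSchedules :
    maximalSchedules n ⊆ feasibleSchedules n := fun _ hs =>
  mem_feasibleSchedules_iff.2 fun p => (mem_maximalSchedules_iff.1 hs p).le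

lemma le_one_of_mem_feasibleSchedules {s : Config n} (hs : s ∈ feasibleSchedules n)
    (i j : Fin n) : s i j ≤ 1 :=
  (Finset.single_le_sum (fun _ _ => Nat.zero_le _) (Finset.mem_univ j)).trans (hs.1 i)

lemma mem_capacityRegion_iff {x : RVec n} :
    x ∈ capacityRegion n ↔ (∀ i j, 0 ≤ x i j) ∧ ∀ p, portSum x p ≤ 1 := by
  rw [Sum.forall]
  rfl

lemma mem_face_iff {n₁ n₂ : ℕ} {x : RVec n} :
    x ∈ face n n₁ n₂ ↔ x ∈ capacityRegion n ∧ ∀ p ∈ saturated n n₁ n₂, portSum x p = 1 := by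
  rw [Sum.forall]
  rfl

lemma saturationRates_eq_image (n₁ n₂ : ℕ) (k : RVec n) :
    saturationRates n₁ n₂ k = portSum k '' saturated n n₁ n₂ := by
  ext x
  rw [Set.mem_image, Sum.exists]
  simp only [saturationRates, Set.mem_ofPred_eq, inl_mem_saturated, inr_mem_saturated, portSum,
    Sum.elim_inl, Sum.elim_inr, eq_comm (a := x)]

section SaturationRates

variable {n₁ n₂ : ℕ} (k : RVec n)

lemma finite_saturationRates (n₁ n₂ : ℕ) (k : RVec n) : (saturationRates n₁ n₂ k).Finite := by
  rw [saturationRates_eq_image]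
  exact Set.toFinite _

lemma portSum_mem_saturationRates {p : Port n} (hp : p ∈ saturated n n₁ n₂) :
    portSum k p ∈ saturationRates n₁ n₂ k := by
  rw [saturationRates_eq_image]
  exact Set.mem_image_of_mem _ hp

lemma kappaMin_le_portSum {p : Port n} (hp : p ∈ saturated n n₁ n₂) :
    kappaMin n₁ n₂ k ≤ portSum k p :=
  csInf_le (finite_saturationRates n₁ n₂ k).bddBelow (portSum_mem_saturationRates k hp)

lemma portSum_le_kappaMax {p : Port n} (hp : p ∈ saturated n n₁ n₂) :
    portSum k p ≤ kappaMax n₁ n₂ k :=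
  le_csSup (finite_saturationRates n₁ n₂ k).bddAbove (portSum_mem_saturationRates k hp)

lemma exists_portSum_eq_kappaMin (h : (saturated n n₁ n₂).Nonempty) :
    ∃ p ∈ saturated n n₁ n₂, portSum k p = kappaMin n₁ n₂ k := by
  rw [kappaMin, saturationRates_eq_image]
  exact (h.image (portSum k)).csInf_mem (Set.toFinite _)

lemma exists_portSum_eq_kappaMax (h : (saturated n n₁ n₂).Nonempty) :
    ∃ p ∈ saturated n n₁ n₂, portSum k p = kappaMax n₁ n₂ k := by
  rw [kappaMax, saturationRates_eq_image]
  exact (h.image (portSum k)).csSup_mem (Set.toFinite _)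

end SaturationRates

end Ports

section Slack

lemma abs_portSum_le {y : RVec n} (hy : ‖vec y‖ ≤ 1) (p : Port n) : |portSum y p| ≤ n := by
  have hentry : ∀ i j, |y i j| ≤ 1 := fun i j => (PiLp.norm_apply_le (vec y) (i, j)).trans hy
  have hsum : ∀ f : Fin n → ℝ, (∀ l, |f l| ≤ 1) → |∑ l, f l| ≤ n := fun f hf =>
    (Finset.abs_sum_le_sum_abs _ _).trans
      (by simpa using Finset.sum_le_sum fun l (_ : l ∈ Finset.univ) => hf l)
  rcases p with i | j
  exacts [hsum _ fun j => hentry i j, hsum _ fun i => hentry i j]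

lemma exists_add_smul_mem_capacityRegion {T : Set (Port n)} {ν : RVec n}
    (hpos : ∀ i j, 0 < ν i j) (hν : ν ∈ capacityRegion n) (hlt : ∀ p ∉ T, portSum ν p < 1) :
    ∃ δ > (0 : ℝ), ∀ y : RVec n, vec y ∈ polarCone (portVec '' T) → ‖vec y‖ ≤ 1 →
      ν + δ • y ∈ capacityRegion n := by
  have hsmall : ∀ c > (0 : ℝ), ∀ b : ℝ, ∀ᶠ δ in 𝓝[>] (0 : ℝ), δ * b ≤ c := fun c hc b =>
    (((continuous_id.mul continuous_const).tendsto' (0 : ℝ) 0 (zero_mul b)).eventually_le_const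
      hc).filter_mono nhdsWithin_le_nhds
  have hev : ∀ᶠ δ in 𝓝[>] (0 : ℝ), 0 < δ ∧ (∀ i j, δ * 1 ≤ ν i j) ∧
      ∀ p, p ∉ T → δ * n ≤ 1 - portSum ν p :=
    eventually_mem_nhdsWithin.and <| (eventually_all.2 fun i => eventually_all.2 fun j =>
      hsmall _ (hpos i j) 1).and <| eventually_all.2 fun p => by
        by_cases hp : p ∈ T
        · exact .of_forall fun _ h => absurd hp h
        · exact (hsmall _ (sub_pos.2 (hlt p hp)) n).mono fun _ h _ => h
  obtain ⟨δ, hδ, hentry, hport⟩ := hev.exists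
  refine ⟨δ, hδ, fun y hy hnorm => mem_capacityRegion_iff.2 ⟨fun i j => ?_, fun p => ?_⟩⟩
  · have hyij : |y i j| ≤ 1 := (PiLp.norm_apply_le (vec y) (i, j)).trans hnorm
    have := mul_le_mul_of_nonneg_left (abs_le.1 hyij).1 hδ.le
    simp only [Pi.add_apply, Pi.smul_apply, smul_eq_mul]
    linarith [hentry i j]
  · rw [portSum_add_smul]
    by_cases hp : p ∈ T
    · have hle : portSum y p ≤ 0 := by
        rw [← inner_portVec_vec]
        exact mem_polarCone.1 hy _ (Set.mem_image_of_mem _ hp)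
      linarith [(mem_capacityRegion_iff.1 hν).2 p, mul_nonpos_of_nonneg_of_nonpos hδ.le hle]
    · have := mul_le_mul_of_nonneg_left (abs_le.1 (abs_portSum_le hnorm p)).2 hδ.le
      linarith [hport p hp]

lemma exists_add_smul_sub_mem_of_mem_intrinsicInterior {F : Type*} [NormedAddCommGroup F]
    [NormedSpace ℝ F] {s : Set F} {ν x : F} (hν : ν ∈ intrinsicInterior ℝ s) (hx : x ∈ s) :
    ∃ t > (0 : ℝ), ν + t • (ν - x) ∈ s := by
  obtain ⟨ν, hν, rfl⟩ := mem_intrinsicInterior.1 hν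
  let line : ℝ → affineSpan ℝ s := fun t => ⟨AffineMap.lineMap (ν : F) x (-t),
    AffineMap.lineMap_mem _ ν.2 (subset_affineSpan ℝ s hx)⟩
  have hcont : Continuous line := by
    refine Continuous.subtype_mk ?_ _
    simp only [AffineMap.lineMap_apply]
    fun_prop
  have hzero : line 0 = ν := Subtype.ext (by simp [line])
  have hev : ∀ᶠ t in 𝓝 (0 : ℝ), line t ∈ interior ((↑) ⁻¹' s : Set (affineSpan ℝ s)) :=
    hcont.continuousAt.eventually_mem (isOpen_interior.mem_nhds (by rwa [hzero]))
  obtain ⟨t, hmem, ht⟩ := ((hev.filter_mono nhdsWithin_le_nhds).and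
    (eventually_mem_nhdsWithin (a := (0 : ℝ)) (s := Set.Ioi 0))).exists
  refine ⟨t, ht, ?_⟩
  have hline : (line t : F) = ν + t • (ν - x) := by
    simp only [line, AffineMap.lineMap_apply, vsub_eq_sub, vadd_eq_add]
    module
  rw [← hline]
  exact Set.mem_preimage.1 (interior_subset hmem)

lemma exists_mem_face_portSum_lt_one {n₁ n₂ : ℕ} (hn₁ : n₁ < n) (hn₂ : n₂ < n) :
    ∃ x ∈ face n n₁ n₂, ∀ p ∉ saturated n n₁ n₂, portSum x p < 1 := by
  have hn : (0 : ℝ) < n := by exact_mod_cast (Nat.zero_le _).trans_lt hn₁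
  have hcard : ∀ m < n, ∑ i : Fin n, (if (i : ℕ) < m then (n : ℝ)⁻¹ else 0) < 1 := by
    intro m hm
    rw [← Finset.sum_filter, Finset.sum_const, nsmul_eq_mul, Fin.card_filter_val_lt,
      min_eq_right hm.le, ← div_eq_mul_inv, div_lt_one hn]
    exact_mod_cast hm
  let x : RVec n := fun i j => if (i : ℕ) < n₁ ∨ (j : ℕ) < n₂ then (n : ℝ)⁻¹ else 0
  have heq : ∀ p ∈ saturated n n₁ n₂, portSum x p = 1 := by
    rintro (i | j) hp <;> simp_all [portSum, rowSum, colSum, x, hn.ne']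
  have hlt : ∀ p ∉ saturated n n₁ n₂, portSum x p < 1 := by
    rintro (i | j) hp
    · rw [inl_mem_saturated] at hp
      simpa [portSum, rowSum, x, hp] using hcard n₂ hn₂
    · rw [inr_mem_saturated] at hp
      simpa [portSum, colSum, x, hp] using hcard n₁ hn₁
  refine ⟨x, mem_face_iff.2 ⟨mem_capacityRegion_iff.2 ⟨fun i j => ?_, fun p => ?_⟩, heq⟩, hlt⟩
  · simp only [x]
    split_ifs <;> positivity
  · by_cases hp : p ∈ saturated n n₁ n₂
    exacts [(heq p hp).le, (hlt p hp).le]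

lemma portSum_lt_one_of_mem_intrinsicInterior_face {n₁ n₂ : ℕ} (hn₁ : n₁ < n) (hn₂ : n₂ < n)
    {ν : RVec n} (hν : ν ∈ intrinsicInterior ℝ (face n n₁ n₂)) {p : Port n}
    (hp : p ∉ saturated n n₁ n₂) : portSum ν p < 1 := by
  obtain ⟨x, hx, hlt⟩ := exists_mem_face_portSum_lt_one hn₁ hn₂
  obtain ⟨t, ht, hmem⟩ := exists_add_smul_sub_mem_of_mem_intrinsicInterior hν hx
  have hle := (mem_capacityRegion_iff.1 hmem.1).2 p
  rw [portSum_add_smul, portSum_sub] at hle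
  by_contra! h
  linarith [mul_pos ht (sub_pos.2 ((hlt p hp).trans_le h))]

end Slack

section MaxWeight

lemma sum_add_mul_div_eq_one {ι : Type*} [Fintype ι] {x c : ι → ℝ} {r : ℝ}
    (hx : ∑ l, x l = 1 - r) (hr : ∑ l, c l = 0 → r = 0) :
    ∑ l, (x l + r * c l / ∑ m, c m) = 1 := by
  rw [Finset.sum_add_distrib, hx, ← Finset.sum_div, ← Finset.mul_sum]
  rcases eq_or_ne (∑ m, c m) 0 with h | h
  · simp [hr h]
  · rw [mul_div_cancel_right₀ _ h, sub_add_cancel]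

/-- The slack of the rows and columns is distributed in product form. -/
lemma exists_mem_doublyStochastic_ge {x : RVec n} (hx : x ∈ capacityRegion n) :
    ∃ M ∈ doublyStochastic ℝ (Fin n), ∀ i j, x i j ≤ M i j := by
  obtain ⟨hx₀, hrow, hcol⟩ := hx
  set r : Fin n → ℝ := fun i => 1 - rowSum x i with hr
  set c : Fin n → ℝ := fun j => 1 - colSum x j with hc
  have hr₀ : ∀ i, 0 ≤ r i := fun i => sub_nonneg.2 (hrow i)
  have hc₀ : ∀ j, 0 ≤ c j := fun j => sub_nonneg.2 (hcol j)
  have hrc : ∑ i, r i = ∑ j, c j := by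
    simp only [hr, hc, Finset.sum_sub_distrib, rowSum, colSum]
    rw [Finset.sum_comm]
  refine ⟨Matrix.of fun i j => x i j + r i * c j / ∑ l, c l, ?_, fun i j => ?_⟩
  · refine mem_doublyStochastic_iff_sum.2 ⟨fun i j => ?_, fun i => ?_, fun j => ?_⟩
    · exact add_nonneg (hx₀ i j) (div_nonneg (mul_nonneg (hr₀ i) (hc₀ j))
        (Finset.sum_nonneg fun l _ => hc₀ l))
    · refine sum_add_mul_div_eq_one (by simp [hr, rowSum]) fun h => ?_
      exact (Finset.sum_eq_zero_iff_of_nonneg fun l _ => hr₀ l).1 (hrc.trans h) i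
        (Finset.mem_univ i)
    · simp only [Matrix.of_apply, mul_comm (r _), ← hrc]
      refine sum_add_mul_div_eq_one (by simp [hc, colSum]) fun h => ?_
      exact (Finset.sum_eq_zero_iff_of_nonneg fun l _ => hc₀ l).1 (hrc.symm.trans h) j
        (Finset.mem_univ j)
  · exact le_add_of_nonneg_right (div_nonneg (mul_nonneg (hr₀ i) (hc₀ j))
      (Finset.sum_nonneg fun l _ => hc₀ l))

lemma inner_natVec_le_of_weight_le {q : Config n} {w : ℕ}
    (hw : ∀ s ∈ feasibleSchedules n, weight q s ≤ w) {x : RVec n} (hx : x ∈ capacityRegion n) :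
    ⟪natVec q, vec x⟫ ≤ w := by
  obtain ⟨M, hM, hxM⟩ := exists_mem_doublyStochastic_ge hx
  obtain ⟨c, hc₀, hc₁, rfl⟩ := exists_eq_sum_perm_of_mem_doublyStochastic hM
  let perm : Equiv.Perm (Fin n) → Config n := fun τ i j => if τ i = j then 1 else 0
  have hperm : ∀ τ, weight q (perm τ) ≤ w := fun τ =>
    hw _ ⟨fun i => by simp [perm], fun j => by simp [perm, ← Equiv.eq_symm_apply]⟩
  have hvec : vec (fun i j => (∑ τ, c τ • Equiv.Perm.permMatrix ℝ τ) i j) =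
      ∑ τ, c τ • natVec (perm τ) := by
    ext e
    simp [vec_apply, natVec_apply, perm, Matrix.sum_apply, PEquiv.toMatrix_apply,
      Equiv.Perm.permMatrix, eq_comm]
  have hM_le : ⟪natVec q, ∑ τ, c τ • natVec (perm τ)⟫ ≤ w := by
    simp only [inner_sum, real_inner_smul_right, inner_natVec_natVec]
    calc ∑ τ, c τ * (weight q (perm τ) : ℝ) ≤ ∑ τ, c τ * w := by
          gcongr with τ; exacts [hc₀ τ, hperm τ]
      _ = w := by rw [← Finset.sum_mul, hc₁, one_mul]
  rw [← hvec] at hM_le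
  refine le_trans ?_ hM_le
  rw [inner_eq_sum, inner_eq_sum]
  exact Finset.sum_le_sum fun i _ => Finset.sum_le_sum fun j _ =>
    mul_le_mul_of_nonneg_left (hxM i j) (Nat.cast_nonneg _)

end MaxWeight

section UnusedService

/-- The service offered to empty queues. Subtraction of natural numbers is truncated at `0`, so
that this is `[s - q - a]⁺`. -/
def unusedService (q a s : Config n) : Config n := fun i j => s i j - (q i j + a i j)

variable {q a s : Config n}

lemma natVec_nextQueue (q a s : Config n) : natVec (nextQueue q a s) =
    natVec q + (natVec a - natVec s + natVec (unusedService q a s)) := by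
  ext ⟨i, j⟩
  have h : nextQueue q a s i j + s i j = q i j + a i j + unusedService q a s i j := by
    simp only [nextQueue, unusedService]
    omega
  have h' : (nextQueue q a s i j : ℝ) + s i j = q i j + a i j + unusedService q a s i j := by
    exact_mod_cast h
  simp only [PiLp.add_apply, PiLp.sub_apply, natVec_apply]
  linarith

lemma nextQueue_mul_unusedService (q a s : Config n) (i j : Fin n) :
    nextQueue q a s i j * unusedService q a s i j = 0 := by
  simp only [nextQueue, unusedService, mul_eq_zero]
  omega

lemma mul_unusedService_eq_zero (hs : s ∈ feasibleSchedules n) (i j : Fin n) :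
    q i j * unusedService q a s i j = 0 := by
  have := le_one_of_mem_feasibleSchedules hs i j
  simp only [unusedService, mul_eq_zero]
  omega

lemma unusedService_le_one (hs : s ∈ feasibleSchedules n) (i j : Fin n) :
    unusedService q a s i j ≤ 1 :=
  (Nat.sub_le _ _).trans (le_one_of_mem_feasibleSchedules hs i j)

lemma inner_polarPart_unusedService_nonpos (T : Set (Port n)) (hs : s ∈ feasibleSchedules n) :
    ⟪polarPart (portVec '' T) (natVec q), natVec (unusedService q a s)⟫ ≤ 0 := by
  have horth : ⟪natVec q, natVec (unusedService q a s)⟫ = 0 := by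
    rw [inner_natVec_natVec, weight]
    exact_mod_cast Finset.sum_eq_zero fun i _ => Finset.sum_eq_zero fun j _ =>
      mul_unusedService_eq_zero hs i j
  have hcone := inner_conePart_nonpos (s := portVec '' T) (natVec q)
    (y := -natVec (unusedService q a s)) <| mem_polarCone.2 <| by
      rintro _ ⟨p, -, rfl⟩
      rw [inner_neg_right, inner_portVec_natVec, neg_nonpos]
      exact Nat.cast_nonneg _
  rw [conePart, inner_neg_right, inner_sub_left, horth] at hcone
  linarith

lemma norm_increment_le {amax : ℕ} (ha : ∀ i j, a i j ≤ amax) (hs : s ∈ feasibleSchedules n) :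
    ‖natVec a - natVec s + natVec (unusedService q a s)‖ ≤ n * (amax + 1) := by
  refine norm_le_of_abs_apply_le (by positivity) fun e => ?_
  have hs₁ : (s e.1 e.2 : ℝ) ≤ 1 := by exact_mod_cast le_one_of_mem_feasibleSchedules hs e.1 e.2
  have ha₁ : (a e.1 e.2 : ℝ) ≤ amax := by exact_mod_cast ha e.1 e.2
  have hu : (unusedService q a s e.1 e.2 : ℝ) ≤ s e.1 e.2 := by exact_mod_cast Nat.sub_le _ _
  simp only [PiLp.add_apply, PiLp.sub_apply, natVec_apply]
  exact abs_le.2 ⟨by linarith [(a e.1 e.2).cast_nonneg (α := ℝ),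
    (unusedService q a s e.1 e.2).cast_nonneg (α := ℝ)], by linarith⟩

end UnusedService

section Drift

/-- Under the policy `pol` and with arrival rates `lam`, the queue lengths drift towards the cone
generated by the indicators of the ports in `T`, at speed at least `η`. -/
def HasConeDrift (T : Set (Port n)) (pol : Policy n) (lam : RVec n) (η : ℝ) : Prop :=
  ∀ q, ∀ s ∈ (pol q).support, s ∈ feasibleSchedules n ∧
    ⟪polarPart (portVec '' T) (natVec q), vec lam - natVec s⟫ ≤
      -η * ‖polarPart (portVec '' T) (natVec q)‖

variable {T : Set (Port n)} {pol : Policy n} {ν : RVec n}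

lemma HasConeDrift.anti {lam : RVec n} {η η' : ℝ} (hd : HasConeDrift T pol lam η) (h : η' ≤ η) :
    HasConeDrift T pol lam η' := fun q s hs =>
  ⟨(hd q s hs).1, (hd q s hs).2.trans <|
    mul_le_mul_of_nonneg_right (neg_le_neg h) (norm_nonneg _)⟩

lemma Policy.IsMaxWeight.inner_polarPart_le (hpol : pol.IsMaxWeight)
    (hν : ∀ p ∈ T, portSum ν p = 1) {δ : ℝ}
    (hslack : ∀ y : RVec n, vec y ∈ polarCone (portVec '' T) → ‖vec y‖ ≤ 1 →
      ν + δ • y ∈ capacityRegion n) {q s : Config n} (hs : s ∈ (pol q).support) :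
    ⟪polarPart (portVec '' T) (natVec q), vec ν - natVec s⟫ ≤
      -δ * ‖polarPart (portVec '' T) (natVec q)‖ := by
  obtain ⟨hmax, hbest⟩ := hpol q s hs
  set x := polarPart (portVec '' T) (natVec q) with hx
  have hcone : ⟪conePart (portVec '' T) (natVec q), vec ν - natVec s⟫ = 0 := by
    refine inner_conePart_eq_zero _ ?_
    rintro _ ⟨p, hp, rfl⟩
    rw [inner_sub_right, inner_portVec_vec, inner_portVec_natVec, hν p hp,
      mem_maximalSchedules_iff.1 hmax p, Nat.cast_one, sub_self]
  obtain ⟨y, hy⟩ := (vec (n := n)).surjective (‖x‖⁻¹ • x)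
  have hmem : ν + δ • y ∈ capacityRegion n := by
    refine hslack y (hy ▸ ?_) (hy ▸ ?_)
    · exact (polarCone _).smul_mem (polarPart_mem _ _) (inv_nonneg.2 (norm_nonneg x))
    · rw [norm_smul, norm_inv, norm_norm]
      exact inv_mul_le_one
  have hle : ⟪natVec q, vec ν⟫ + δ * ‖x‖ ≤ weight q s := by
    have h := inner_natVec_le_of_weight_le hbest hmem
    rwa [map_add, map_smul, hy, inner_add_right, real_inner_smul_right, real_inner_smul_right,
      inner_polarPart_self, ← hx, sq, ← mul_assoc ‖x‖⁻¹,
      inv_mul_mul_self] at h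
  rw [conePart, ← hx, inner_sub_left, sub_eq_zero] at hcone
  rw [← hcone, inner_sub_right, inner_natVec_natVec]
  linarith

lemma Policy.IsMaxWeight.hasConeDrift (hpol : pol.IsMaxWeight) (hν : ∀ p ∈ T, portSum ν p = 1)
    {δ : ℝ} (hslack : ∀ y : RVec n, vec y ∈ polarCone (portVec '' T) → ‖vec y‖ ≤ 1 →
      ν + δ • y ∈ capacityRegion n) {k : RVec n} {ε : ℝ} (hε : 0 ≤ ε) :
    HasConeDrift T pol (ν - ε • k) (δ - ε * ‖vec k‖) := by
  refine fun q s hs =>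
    ⟨maximalSchedules_subset_feasibleSchedules (hpol q s hs).1, ?_⟩
  have hν' := hpol.inner_polarPart_le hν hslack hs
  set x := polarPart (portVec '' T) (natVec q)
  have hk : -(ε * ⟪x, vec k⟫) ≤ ε * (‖x‖ * ‖vec k‖) := by
    rw [← mul_neg]
    exact mul_le_mul_of_nonneg_left
      ((neg_le_abs _).trans (abs_real_inner_le_norm _ _)) hε
  calc ⟪x, vec (ν - ε • k) - natVec s⟫
      = ⟪x, vec ν - natVec s⟫ - ε * ⟪x, vec k⟫ := by
        rw [map_sub, map_smul, sub_right_comm, inner_sub_right, real_inner_smul_right]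
    _ ≤ -(δ - ε * ‖vec k‖) * ‖x‖ := by linarith

lemma cube_le_of_sq_le {x y c z : ℝ} (hx : 0 ≤ x) (hxy : |y - x| ≤ c)
    (hsq : y ^ 2 ≤ x ^ 2 + 2 * z + c ^ 2) :
    y ^ 3 ≤ x ^ 3 + 3 * x * z + 3 * c ^ 2 * x + c ^ 3 := by
  have hy : y ≤ x + c := by linarith [(abs_le.1 hxy).2]
  have hc : (y - x) ^ 2 ≤ c ^ 2 := sq_le_sq' (abs_le.1 hxy).1 (abs_le.1 hxy).2
  have h₁ : x * y ^ 2 ≤ x * (x ^ 2 + 2 * z + c ^ 2) := by gcongr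
  have h₂ : (y - x) ^ 2 * (y + x / 2) ≤ c ^ 2 * (x + c + x / 2) := by
    have hc₀ : 0 ≤ c := (abs_nonneg _).trans hxy
    calc (y - x) ^ 2 * (y + x / 2) ≤ (y - x) ^ 2 * (x + c + x / 2) := by gcongr
      _ ≤ _ := by gcongr
  linear_combination 3 / 2 * h₁ + h₂

lemma norm_polarPart_nextQueue_pow_three_le (T : Set (Port n)) {q a s : Config n} {amax : ℕ}
    (ha : ∀ i j, a i j ≤ amax) (hs : s ∈ feasibleSchedules n) :
    ‖polarPart (portVec '' T) (natVec (nextQueue q a s))‖ ^ 3 ≤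
      ‖polarPart (portVec '' T) (natVec q)‖ ^ 3 +
        3 * ‖polarPart (portVec '' T) (natVec q)‖ *
          ⟪polarPart (portVec '' T) (natVec q), natVec a - natVec s⟫ +
        3 * (n * (amax + 1)) ^ 2 * ‖polarPart (portVec '' T) (natVec q)‖ +
        (n * (amax + 1)) ^ 3 := by
  have hd := norm_increment_le (q := q) ha hs
  have hu := inner_polarPart_unusedService_nonpos (q := q) (a := a) T hs
  rw [natVec_nextQueue]
  refine cube_le_of_sq_le (norm_nonneg _)
    ((abs_norm_polarPart_add_sub_le _ _ _).trans hd) ?_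
  set d := natVec a - natVec s + natVec (unusedService q a s) with hd_def
  calc _ ≤ ‖polarPart (portVec '' T) (natVec q) + d‖ ^ 2 := by
        gcongr
        exact norm_polarPart_add_le _ _ _
    _ = ‖polarPart (portVec '' T) (natVec q)‖ ^ 2 +
          2 * ⟪polarPart (portVec '' T) (natVec q), d⟫ + ‖d‖ ^ 2 := norm_add_sq_real _ _
    _ ≤ _ := by
        gcongr
        rw [hd_def, inner_add_right]
        linarith

/-- The additive constant in the drift inequality for the cube of the distance to the cone, for
increments bounded by `c` and drift speed `η`. -/
noncomputable def driftConst (c η : ℝ) : ℝ := 9 * c ^ 4 / (4 * η) + c ^ 3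

lemma driftConst_nonneg {c η : ℝ} (hc : 0 ≤ c) (hη : 0 ≤ η) : 0 ≤ driftConst c η := by
  unfold driftConst
  positivity

lemma cube_drift_le {x c η z : ℝ} (hx : 0 ≤ x) (hη : 0 < η) (hz : z ≤ -η * x) :
    x ^ 3 + 3 * x * z + 3 * c ^ 2 * x + c ^ 3 + 2 * η * x ^ 2 ≤ x ^ 3 + driftConst c η := by
  have hxz : x * z ≤ x * (-η * x) := mul_le_mul_of_nonneg_left hz hx
  have hamgm : 3 * c ^ 2 * x ≤ η * x ^ 2 + 9 * c ^ 4 / (4 * η) := by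
    have hsq : η * x ^ 2 + 9 * c ^ 4 / (4 * η) - 3 * c ^ 2 * x =
        (2 * η * x - 3 * c ^ 2) ^ 2 / (4 * η) := by
      field_simp
      ring
    have : 0 ≤ (2 * η * x - 3 * c ^ 2) ^ 2 / (4 * η) := by positivity
    linarith
  unfold driftConst
  linarith

end Drift

section PortProjection

/-- The orthogonal projection onto the span of the indicators of the ports in `T`. -/
noncomputable def portProj (T : Set (Port n)) : Vec n →L[ℝ] Vec n :=
  (Submodule.span ℝ (portVec '' T)).starProjection

lemma inner_portProj_left (T : Set (Port n)) (x y : Vec n) :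
    ⟪portProj T x, y⟫ = ⟪x, portProj T y⟫ :=
  Submodule.inner_starProjection_left_eq_right _ x y

lemma norm_portProj_le (T : Set (Port n)) (x : Vec n) : ‖portProj T x‖ ≤ ‖x‖ :=
  Submodule.norm_starProjection_apply_le _ x

lemma inner_portProj_portProj (T : Set (Port n)) (x y : Vec n) :
    ⟪portProj T x, portProj T y⟫ = ⟪portProj T x, y⟫ := by
  rw [inner_portProj_left, inner_portProj_left]
  exact congrArg _ <|
    Submodule.starProjection_eq_self_iff.2 (Submodule.starProjection_apply_mem _ y)

lemma portProj_eq_of_forall_inner_eq {T : Set (Port n)} {x y : Vec n}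
    (h : ∀ p ∈ T, ⟪portVec p, x⟫ = ⟪portVec p, y⟫) : portProj T x = portProj T y := by
  rw [← sub_eq_zero, ← map_sub]
  refine (Submodule.starProjection_apply_eq_zero_iff _).2
    ((Submodule.isOrtho_span.2 ?_).symm (Submodule.mem_span_singleton_self _))
  rintro _ ⟨p, hp, rfl⟩ _ rfl
  rw [inner_sub_right, h p hp, sub_self]

/-- The restriction of the vector `x` to the pairs that have a port in `T`. -/
noncomputable def coveredPart (T : Set (Port n)) (x : Vec n) : Vec n :=
  WithLp.toLp 2 ({e | .inl e.1 ∈ T ∨ .inr e.2 ∈ T}.indicator x)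

lemma portProj_coveredPart (T : Set (Port n)) (x : Vec n) :
    portProj T (coveredPart T x) = portProj T x := by
  refine portProj_eq_of_forall_inner_eq fun p hp => ?_
  rw [inner_eq_sum, inner_eq_sum]
  refine Finset.sum_congr rfl fun i _ => Finset.sum_congr rfl fun j _ => ?_
  by_cases he : .inl i ∈ T ∨ .inr j ∈ T
  · have : coveredPart T x (i, j) = x (i, j) := Set.indicator_of_mem (by exact he) _
    rw [this]
  · have hzero : portVec p (i, j) = 0 := by
      rcases p with i' | j'
      · have : i ≠ i' := fun h => he (.inl (h ▸ hp))
        simp [portVec, natVec_apply, portConfig, this]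
      · have : j ≠ j' := fun h => he (.inr (h ▸ hp))
        simp [portVec, natVec_apply, portConfig, this]
    rw [hzero, zero_mul, zero_mul]

lemma inner_portProj_coveredPart (T : Set (Port n)) (x y : Vec n) :
    ⟪portProj T x, coveredPart T y⟫ = ⟪portProj T x, y⟫ := by
  rw [inner_portProj_left, portProj_coveredPart, inner_portProj_left]

lemma norm_coveredPart_sq_le (T : Set (Port n)) {u : Config n} (hu : ∀ i j, u i j ≤ 1) :
    ‖coveredPart T (natVec u)‖ ^ 2 ≤
      ∑ p, T.indicator (fun p => (weight (portConfig p) u : ℝ)) p := by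
  classical
  have hrow : ∑ i, T.indicator (fun p => (weight (portConfig p) u : ℝ)) (.inl i) =
      ∑ i, ∑ j, if .inl i ∈ T then (u i j : ℝ) else 0 :=
    Finset.sum_congr rfl fun i _ => by
      by_cases h : .inl i ∈ T <;> simp [h, weight_portConfig_inl]
  have hcol : ∑ j, T.indicator (fun p => (weight (portConfig p) u : ℝ)) (.inr j) =
      ∑ i, ∑ j, if .inr j ∈ T then (u i j : ℝ) else 0 := by
    rw [Finset.sum_comm]
    exact Finset.sum_congr rfl fun j _ => by
      by_cases h : .inr j ∈ T <;> simp [h, weight_portConfig_inr]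
  rw [Fintype.sum_sum_type, hrow, hcol, ← Finset.sum_add_distrib, EuclideanSpace.norm_sq_eq,
    Fintype.sum_prod_type]
  refine Finset.sum_le_sum fun i _ => ?_
  rw [← Finset.sum_add_distrib]
  refine Finset.sum_le_sum fun j _ => ?_
  have hsq : (u i j : ℝ) ^ 2 ≤ u i j :=
    sq_le (Nat.cast_nonneg _) (by exact_mod_cast hu i j)
  by_cases h₁ : Sum.inl i ∈ T <;> by_cases h₂ : Sum.inr j ∈ T <;>
    simp [coveredPart, Set.indicator, natVec_apply, h₁, h₂] <;>
    linarith [(u i j).cast_nonneg (α := ℝ)]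

lemma portProj_eq_sum_smul {T : Set (Port n)} {x : Vec n} {γ : Port n → ℝ}
    (hγ : ∀ p ∉ T, γ p = 0)
    (hx : ∀ p ∈ T, ⟪portVec p, ∑ p', γ p' • portVec p'⟫ = ⟪portVec p, x⟫) :
    portProj T x = ∑ p, γ p • portVec p := by
  rw [← portProj_eq_of_forall_inner_eq hx]
  refine Submodule.starProjection_eq_self_iff.2 (Submodule.sum_mem _ fun p _ => ?_)
  by_cases hp : p ∈ T
  · exact Submodule.smul_mem _ _ (Submodule.subset_span (Set.mem_image_of_mem _ hp))
  · rw [hγ p hp, zero_smul]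
    exact Submodule.zero_mem _

lemma sum_smul_portVec_apply (γ : Port n → ℝ) (i j : Fin n) :
    (∑ p, γ p • portVec p) (i, j) = γ (.inl i) + γ (.inr j) := by
  simp [portVec, natVec_apply, portConfig]

lemma inner_portVec_inl_sum_smul (γ : Port n → ℝ) (i : Fin n) :
    ⟪portVec (.inl i), ∑ p, γ p • portVec p⟫ = n * γ (.inl i) + ∑ j, γ (.inr j) := by
  simp [inner_eq_sum, portVec, natVec_apply, portConfig, Finset.sum_add_distrib]

lemma inner_portVec_inr_sum_smul (γ : Port n → ℝ) (j : Fin n) :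
    ⟪portVec (.inr j), ∑ p, γ p • portVec p⟫ = ∑ i, γ (.inl i) + n * γ (.inr j) := by
  simp [inner_eq_sum, portVec, natVec_apply, portConfig, Finset.sum_add_distrib]

lemma inner_portVec_inl_single (l i j : Fin n) :
    ⟪portVec (.inl l), EuclideanSpace.single (i, j) 1⟫ = if l = i then 1 else 0 := by
  simp [EuclideanSpace.inner_single_right, portVec, natVec_apply, portConfig, eq_comm (a := l)]

lemma inner_portVec_inr_single (l i j : Fin n) :
    ⟪portVec (.inr l), EuclideanSpace.single (i, j) 1⟫ = if l = j then 1 else 0 := by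
  simp [EuclideanSpace.inner_single_right, portVec, natVec_apply, portConfig, eq_comm (a := l)]

lemma sum_indicator_single_sub {m : ℕ} (hm : m < n) (i : Fin n) (c : ℝ) :
    ∑ l : Fin n, (if (l : ℕ) < m then ((if l = i then 1 else 0) - c) / n else 0) =
      ((if (i : ℕ) < m then 1 else 0) - m * c) / n := by
  have hcard : ∑ l : Fin n, (if (l : ℕ) < m then c else 0) = m * c := by
    rw [← Finset.sum_filter, Finset.sum_const, Fin.card_filter_val_lt, min_eq_right hm.le,
      nsmul_eq_mul]
  have hsingle : ∑ l : Fin n, (if (l : ℕ) < m then (if l = i then 1 else 0) else 0 : ℝ) =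
      if (i : ℕ) < m then 1 else 0 := by
    rw [Finset.sum_eq_single i (fun l _ hl => by simp [hl]) (by simp), if_pos rfl]
  rw [← hcard, ← hsingle, ← Finset.sum_sub_distrib, Finset.sum_div]
  exact Finset.sum_congr rfl fun l _ => by split_ifs <;> simp

/-- The coefficients of the projection solve the normal equations of the saturated ports, whose
determinant is a multiple of `n² - n₁ n₂`. -/
lemma portProj_saturated_single_apply {n₁ n₂ : ℕ} (hn₁ : n₁ < n) (hn₂ : n₂ < n) (i j : Fin n) :
    n * portProj (saturated n n₁ n₂) (EuclideanSpace.single (i, j) 1) (i, j) =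
      zeta n n₁ n₂ i j := by
  have hn : (n : ℝ) ≠ 0 := by exact_mod_cast (Nat.zero_le _).trans_lt hn₁ |>.ne'
  have hD : (n : ℝ) ^ 2 - n₁ * n₂ ≠ 0 := by
    have : (n₁ : ℝ) * n₂ < n * n := by exact_mod_cast Nat.mul_lt_mul'' hn₁ hn₂
    linarith
  set r : ℝ := if (i : ℕ) < n₁ then 1 else 0 with hr
  set c : ℝ := if (j : ℕ) < n₂ then 1 else 0 with hc
  set D : ℝ := (n : ℝ) ^ 2 - n₁ * n₂ with hD_def
  let γ : Port n → ℝ := Sum.elim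
    (fun l => if (l : ℕ) < n₁ then ((if l = i then 1 else 0) - (n * c - n₂ * r) / D) / n else 0)
    (fun l => if (l : ℕ) < n₂ then ((if l = j then 1 else 0) - (n * r - n₁ * c) / D) / n else 0)
  have hproj : portProj (saturated n n₁ n₂) (EuclideanSpace.single (i, j) 1) =
      ∑ p, γ p • portVec p := by
    refine portProj_eq_sum_smul ?_ ?_
    · rintro (l | l) hl <;> exact if_neg hl
    · rintro (l | l) hl <;> replace hl := by simpa using hl
      · rw [inner_portVec_inl_sum_smul, inner_portVec_inl_single]
        simp only [γ, Sum.elim_inl, Sum.elim_inr, if_pos hl, sum_indicator_single_sub hn₂]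
        field_simp
        ring
      · rw [inner_portVec_inr_sum_smul, inner_portVec_inr_single]
        simp only [γ, Sum.elim_inl, Sum.elim_inr, if_pos hl, sum_indicator_single_sub hn₁]
        field_simp
        ring
  rw [hproj, sum_smul_portVec_apply]
  simp only [γ, Sum.elim_inl, Sum.elim_inr, zeta, ← hD_def, hr, hc]
  split_ifs <;> field_simp <;> ring

lemma norm_portProj_single_sq {n₁ n₂ : ℕ} (hn₁ : n₁ < n) (hn₂ : n₂ < n) (i j : Fin n) :
    n * ‖portProj (saturated n n₁ n₂) (EuclideanSpace.single (i, j) 1)‖ ^ 2 =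
      zeta n n₁ n₂ i j := by
  rw [← portProj_saturated_single_apply hn₁ hn₂, ← real_inner_self_eq_norm_sq,
    inner_portProj_portProj, EuclideanSpace.inner_single_right]
  simp

/-- The variance of the projection onto the span of the indicators of the ports in `T` of a random
vector with independent coordinates, whose variances are `τ`. -/
noncomputable def projVar (T : Set (Port n)) (τ : RVec n) : ℝ :=
  ∑ i, ∑ j, τ i j * ‖portProj T (EuclideanSpace.single (i, j) 1)‖ ^ 2

lemma continuous_projVar (T : Set (Port n)) : Continuous (projVar T) := by
  unfold projVar
  fun_prop

lemma projVar_empty (τ : RVec n) : projVar ∅ τ = 0 := by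
  simp [projVar, portProj]

lemma mul_projVar_saturated {n₁ n₂ : ℕ} (hn₁ : n₁ < n) (hn₂ : n₂ < n) (τ : RVec n) :
    n * projVar (saturated n n₁ n₂) τ = dot τ (zeta n n₁ n₂) := by
  simp only [projVar, dot, Finset.mul_sum, mul_left_comm (n : ℝ), norm_portProj_single_sq hn₁ hn₂]

end PortProjection

section SaturationRates

lemma inner_conePart_vec_le {T : Set (Port n)} {y z : RVec n}
    (h : ∀ p ∈ T, portSum y p ≤ portSum z p) (x : Vec n) :
    ⟪conePart (portVec '' T) x, vec y⟫ ≤ ⟪conePart (portVec '' T) x, vec z⟫ := by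
  rw [← sub_nonpos, ← inner_sub_right]
  refine inner_conePart_nonpos x (mem_polarCone.2 ?_)
  rintro _ ⟨p, hp, rfl⟩
  rw [inner_sub_right, inner_portVec_vec, inner_portVec_vec, sub_nonpos]
  exact h p hp

lemma portSum_one (p : Port n) : portSum 1 p = n := by
  rcases p with i | j <;> simp [portSum, rowSum, colSum]

lemma inner_natVec_one (q : Config n) : ⟪natVec q, vec 1⟫ = ∑ i, ∑ j, (q i j : ℝ) := by
  simp [inner_eq_sum, natVec_apply, vec_apply]

end SaturationRates

section MarkovChain

variable {X : Type*} [MeasurableSpace X] {K : Kernel X X}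

lemma lintegral_lintegral_of_invariant {π : Measure X} (hπ : K.Invariant π) {f : X → ℝ≥0∞}
    (hf : Measurable f) : ∫⁻ x, ∫⁻ y, f y ∂K x ∂π = ∫⁻ x, f x ∂π := by
  conv_rhs => rw [← hπ.def]
  rw [Measure.lintegral_bind K.measurable.aemeasurable hf.aemeasurable]

lemma measure_singleton_ne_zero_of_invariant [MeasurableSingletonClass X] {π : Measure X}
    (hπ : K.Invariant π) {x y : X} (hx : π {x} ≠ 0) (hxy : K x {y} ≠ 0) : π {y} ≠ 0 := by
  rw [← hπ.def, Measure.bind_apply (measurableSet_singleton y) K.measurable.aemeasurable]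
  refine ne_of_gt ((ENNReal.mul_pos hxy hx).trans_le ?_)
  rw [← lintegral_singleton (fun x => K x {y}) x]
  exact setLIntegral_le_lintegral _ _

lemma pow_succ_apply_eq_bind (x : X) (t : ℕ) : (K ^ (t + 1)) x = ((K ^ t) x).bind K := by
  rw [pow_succ']
  exact Kernel.comp_apply _ _ _

variable [IsMarkovKernel K]

lemma lintegral_min_add_indicator_le_of_drift {f g : X → ℝ≥0∞} {C : ℝ≥0∞} {x : X}
    (h : ∫⁻ y, f y ∂K x + g x ≤ f x + C) (N : ℝ≥0∞) :
    ∫⁻ y, min (f y) N ∂K x + {x | f x ≤ N}.indicator g x ≤ min (f x) N + C := by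
  by_cases hx : f x ≤ N
  · rw [Set.indicator_of_mem (by exact hx), min_eq_left hx]
    exact (by gcongr; exact min_le_left _ _ : _ ≤ ∫⁻ y, f y ∂K x + g x).trans h
  · rw [Set.indicator_of_notMem (by exact hx), min_eq_right (not_le.1 hx).le, add_zero]
    calc ∫⁻ y, min (f y) N ∂K x ≤ ∫⁻ _, N ∂K x := lintegral_mono fun y => min_le_right _ _
      _ ≤ N + C := by simp

/-- The Lyapunov function `f` need not be `π`-integrable: its truncations are. -/
lemma lintegral_le_of_drift {π : Measure X} [IsProbabilityMeasure π] (hπ : K.Invariant π)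
    {f g : X → ℝ≥0∞} (hf : Measurable f) (hg : Measurable g) (hf_ne_top : ∀ x, f x ≠ ∞)
    {C : ℝ≥0∞} (h : ∀ x, ∫⁻ y, f y ∂K x + g x ≤ f x + C) : ∫⁻ x, g x ∂π ≤ C := by
  have hmeas (N : ℕ) : MeasurableSet {x | f x ≤ N} := measurableSet_le hf measurable_const
  have htrunc (N : ℕ) : ∫⁻ x in {x | f x ≤ N}, g x ∂π ≤ C := by
    have hint := lintegral_mono (μ := π) fun x => lintegral_min_add_indicator_le_of_drift (h x) N
    rw [lintegral_add_right _ (hg.indicator (hmeas N)), lintegral_indicator (hmeas N),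
      lintegral_add_right _ measurable_const, lintegral_const, measure_univ, mul_one,
      lintegral_lintegral_of_invariant hπ (hf.min measurable_const)] at hint
    refine (ENNReal.add_le_add_iff_left (ne_top_of_le_ne_top (ENNReal.natCast_ne_top N) ?_)).1 hint
    calc ∫⁻ y, min (f y) N ∂π ≤ ∫⁻ _, N ∂π := lintegral_mono fun y => min_le_right _ _
      _ = N := by simp
  have hmono : Monotone fun N : ℕ => {x | f x ≤ N} := fun M N hMN x (hx : f x ≤ M) =>
    hx.trans (by exact_mod_cast hMN)
  have hcover : ⋃ N : ℕ, {x | f x ≤ N} = Set.univ := Set.iUnion_eq_univ_iff.2 fun x =>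
    (ENNReal.exists_nat_gt (hf_ne_top x)).imp fun _ => le_of_lt
  rw [← setLIntegral_univ, ← hcover, setLIntegral_iUnion_of_directed _ hmono.directed_le]
  exact iSup_le htrunc

lemma bind_univ (μ : Measure X) : μ.bind K Set.univ = μ Set.univ := by
  rw [Measure.bind_apply MeasurableSet.univ K.measurable.aemeasurable]
  simp

lemma sub_invariant {π₁ π₂ : Measure X} [IsFiniteMeasure π₁] [IsFiniteMeasure π₂]
    (h₁ : K.Invariant π₁) (h₂ : K.Invariant π₂) : K.Invariant (π₁ - π₂) := by
  have hle : π₁ - π₂ ≤ (π₁ - π₂).bind K := by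
    refine Measure.sub_le_of_le_add ?_
    calc π₁ = π₁.bind K := h₁.def.symm
      _ ≤ ((π₁ - π₂) + π₂).bind K := by
        refine Measure.le_intro fun s hs _ => ?_
        rw [Measure.bind_apply hs K.measurable.aemeasurable,
          Measure.bind_apply hs K.measurable.aemeasurable]
        exact lintegral_mono' (Measure.sub_le_iff_le_add.1 le_rfl) le_rfl
      _ = (π₁ - π₂).bind K + π₂ := by rw [Measure.comp_add, h₂.def]
  exact (Measure.eq_of_le_of_measure_univ_eq hle (bind_univ _).symm).symm

variable (K) in
/-- The mean over the times `0, …, N` of the laws of the chain with kernel `K` started at `x`. -/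
noncomputable def timeAverage (x : X) (N : ℕ) : Measure X :=
  (N + 1 : ℝ≥0∞)⁻¹ • ∑ t ∈ Finset.range (N + 1), (K ^ t) x

lemma inv_mul_natCast_succ (N : ℕ) : (N + 1 : ℝ≥0∞)⁻¹ * (N + 1) = 1 :=
  ENNReal.inv_mul_cancel (by simp) (by finiteness)

instance isMarkovKernel_pow (t : ℕ) : IsMarkovKernel (K ^ t) := by
  induction t with
  | zero => exact inferInstanceAs (IsMarkovKernel Kernel.id)
  | succ t ih => exact inferInstanceAs (IsMarkovKernel ((K ^ t) ∘ₖ K))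

instance isProbabilityMeasure_timeAverage (x : X) (N : ℕ) :
    IsProbabilityMeasure (timeAverage K x N) := by
  constructor
  simp [timeAverage, inv_mul_natCast_succ]

lemma lintegral_timeAverage_le_of_drift {f g : X → ℝ≥0∞} (hf : Measurable f) (hg : Measurable g)
    {C : ℝ≥0∞} (h : ∀ x, ∫⁻ y, f y ∂K x + g x ≤ f x + C) (x : X) (N : ℕ) :
    ∫⁻ y, g y ∂timeAverage K x N ≤ f x + C := by
  have hsum (t : ℕ) : ∫⁻ y, f y ∂(K ^ t) x + ∑ r ∈ Finset.range t, ∫⁻ y, g y ∂(K ^ r) x ≤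
      f x + t * C := by
    induction t with
    | zero =>
      simp only [pow_zero, Finset.range_zero, Finset.sum_empty, Nat.cast_zero, zero_mul, add_zero]
      exact (lintegral_dirac' x hf).le
    | succ t ih =>
      have hstep : ∫⁻ y, f y ∂(K ^ (t + 1)) x + ∫⁻ y, g y ∂(K ^ t) x ≤
          ∫⁻ y, f y ∂(K ^ t) x + C := by
        have hint := lintegral_mono (μ := (K ^ t) x) h
        rwa [lintegral_add_right _ hg, lintegral_add_right _ measurable_const, lintegral_const,
          measure_univ, mul_one, ← Measure.lintegral_bind K.measurable.aemeasurable hf.aemeasurable,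
          ← pow_succ_apply_eq_bind] at hint
      rw [Finset.sum_range_succ, add_comm (Finset.sum _ _), ← add_assoc]
      calc _ ≤ ∫⁻ y, f y ∂(K ^ t) x + C + ∑ r ∈ Finset.range t, ∫⁻ y, g y ∂(K ^ r) x := by gcongr
        _ = ∫⁻ y, f y ∂(K ^ t) x + ∑ r ∈ Finset.range t, ∫⁻ y, g y ∂(K ^ r) x + C := by ring
        _ ≤ f x + t * C + C := by gcongr
        _ = f x + (t + 1 : ℕ) * C := by push_cast; ring
  rw [timeAverage, lintegral_smul_measure, lintegral_finsetSum_measure, smul_eq_mul]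
  calc _ ≤ (N + 1 : ℝ≥0∞)⁻¹ * (f x + (N + 1) * C) := by
        gcongr
        exact_mod_cast le_add_self.trans (hsum (N + 1))
    _ = (N + 1 : ℝ≥0∞)⁻¹ * f x + C := by
        rw [mul_add, ← mul_assoc, inv_mul_natCast_succ, one_mul]
    _ ≤ f x + C := by
        gcongr
        exact mul_le_of_le_one_left zero_le (ENNReal.inv_le_one.2 le_add_self)

lemma timeAverage_bind_le (x : X) (N : ℕ) {S : Set X} (hS : MeasurableSet S) :
    (timeAverage K x N).bind K S ≤ timeAverage K x N S + (N + 1 : ℝ≥0∞)⁻¹ := by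
  have hbind : (timeAverage K x N).bind K S =
      (N + 1 : ℝ≥0∞)⁻¹ * ∑ t ∈ Finset.range (N + 1), (K ^ (t + 1)) x S := by
    rw [Measure.bind_apply hS K.measurable.aemeasurable, timeAverage, lintegral_smul_measure,
      lintegral_finsetSum_measure, smul_eq_mul]
    simp only [Kernel.pow_succ_apply_eq_lintegral _ _ _ hS]
  rw [hbind, timeAverage, Measure.smul_apply, Measure.finsetSum_apply, smul_eq_mul, ← mul_add_one]
  gcongr
  rw [Finset.sum_range_succ, Finset.sum_range_succ']
  gcongr
  · exact le_self_add
  · exact prob_le_one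

/-- Prokhorov's theorem, along an ultrafilter, for the discrete topology. -/
lemma exists_tendsto_lintegral_of_tight [Countable X] [MeasurableSingletonClass X]
    {μ : ℕ → Measure X} (hμ : ∀ N, IsProbabilityMeasure (μ N)) {g : X → ℝ≥0∞}
    (hg_fin : ∀ R : ℕ, {x | g x ≤ R}.Finite) {B : ℝ≥0∞} (hB : B ≠ ∞)
    (hμg : ∀ N, ∫⁻ x, g x ∂μ N ≤ B) :
    ∃ (F : Filter ℕ) (π : Measure X), F.NeBot ∧ F ≤ atTop ∧ IsProbabilityMeasure π ∧
      ∀ φ : X → ℝ≥0∞, (∀ x, φ x ≤ 1) →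
        Tendsto (fun N => ∫⁻ x, φ x ∂μ N) F (𝓝 (∫⁻ x, φ x ∂π)) := by
  let _ : TopologicalSpace X := ⊥
  have : DiscreteTopology X := ⟨rfl⟩
  have : BorelSpace X :=
    ⟨by rw [borel_eq_top_of_discrete]; exact eq_top_iff.2 fun _ _ => .of_discrete⟩
  let P (N : ℕ) : ProbabilityMeasure X := ⟨μ N, hμ N⟩
  let u (R : ℕ) : NNReal := B.toNNReal / (R + 1)
  have hu : Tendsto u atTop (𝓝 0) := by
    simpa only [Nat.cast_add, Nat.cast_one, Function.comp_def] using
      (tendsto_const_div_atTop_nhds_zero_nat (𝕜 := NNReal) B.toNNReal).comp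
        (tendsto_add_atTop_nat 1)
  have hcompact := isCompact_setOfPred_probabilityMeasure_mass_eq_compl_isCompact_le hu
    (fun R => (hg_fin (R + 1)).isCompact) (Or.inl inferInstance)
  have hmem (N R : ℕ) : P N {x | g x ≤ (R + 1 : ℕ)}ᶜ ≤ u R := by
    rw [← ENNReal.coe_le_coe, ProbabilityMeasure.ennreal_coeFn_eq_coeFn_toMeasure]
    calc μ N {x | g x ≤ (R + 1 : ℕ)}ᶜ ≤ μ N {x | (R + 1 : ℕ) ≤ g x} :=
          measure_mono fun x (hx : ¬ g x ≤ _) => (not_le.1 hx).le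
      _ ≤ (∫⁻ x, g x ∂μ N) / (R + 1 : ℕ) :=
          meas_ge_le_lintegral_div Measurable.of_discrete.aemeasurable (by simp) (by finiteness)
      _ ≤ u R := by
          rw [ENNReal.coe_div (by positivity), ENNReal.coe_toNNReal hB]
          push_cast
          gcongr
          exact hμg N
  obtain ⟨π, -, hπ⟩ := isCompact_iff_ultrafilter_le_nhds'.1 hcompact ((hyperfilter ℕ).map P)
    (mem_map.2 (univ_mem' hmem))
  refine ⟨hyperfilter ℕ, π, inferInstance, Nat.hyperfilter_le_atTop, inferInstance, fun φ hφ => ?_⟩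
  have hφ_ne_top (x : X) : φ x ≠ ∞ := ne_top_of_le_ne_top ENNReal.one_ne_top (hφ x)
  have hφ_le (x : X) : (φ x).toNNReal ≤ 1 := by
    simpa using ENNReal.toNNReal_mono ENNReal.one_ne_top (hφ x)
  have hdist (x y : X) : dist (φ x).toNNReal (φ y).toNNReal ≤ 1 :=
    abs_sub_le_of_nonneg_of_le (NNReal.coe_nonneg _) (hφ_le x) (NNReal.coe_nonneg _) (hφ_le y)
  have hπ' : Tendsto P (hyperfilter ℕ) (𝓝 π) := hπ
  simpa [P, ENNReal.coe_toNNReal (hφ_ne_top _)] using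
    ProbabilityMeasure.tendsto_iff_forall_lintegral_tendsto.1 hπ'
      (.mkOfDiscrete (fun x => (φ x).toNNReal) 1 hdist)

/-- Krylov–Bogoliubov: the drift condition makes the time averages tight, and a limit point of
them is invariant. -/
lemma exists_invariant_of_drift [Countable X] [MeasurableSingletonClass X] (x₀ : X)
    {f g : X → ℝ≥0∞} (hf_ne_top : f x₀ ≠ ∞) {C : ℝ≥0∞} (hC : C ≠ ∞)
    (hg : ∀ R : ℕ, {x | g x ≤ R}.Finite) (h : ∀ x, ∫⁻ y, f y ∂K x + g x ≤ f x + C) :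
    ∃ π : Measure X, IsProbabilityMeasure π ∧ K.Invariant π := by
  obtain ⟨F, π, _, hF, _, hπ⟩ := exists_tendsto_lintegral_of_tight
    (isProbabilityMeasure_timeAverage (K := K) x₀) hg (ENNReal.add_ne_top.2 ⟨hf_ne_top, hC⟩)
    (lintegral_timeAverage_le_of_drift .of_discrete .of_discrete h x₀)
  refine ⟨π, inferInstance, Measure.eq_of_le_of_measure_univ_eq ?_ (bind_univ π)⟩
  refine Measure.le_intro fun S hS _ => ?_
  have hbind : Tendsto (fun N => (timeAverage K x₀ N).bind K S) F (𝓝 (π.bind K S)) := by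
    simp only [Measure.bind_apply hS K.measurable.aemeasurable]
    exact hπ (fun x => K x S) fun x => prob_le_one
  have hset : Tendsto (fun N => timeAverage K x₀ N S) F (𝓝 (π S)) := by
    simpa only [lintegral_indicator_one hS] using hπ (S.indicator 1) fun x =>
      Set.indicator_le_self' (fun _ _ => zero_le) x
  have hinv : Tendsto (fun N : ℕ => (N + 1 : ℝ≥0∞)⁻¹) F (𝓝 0) := by
    simpa only [Nat.cast_add, Nat.cast_one, Function.comp_def] using
      (ENNReal.tendsto_inv_nat_nhds_zero.comp (tendsto_add_atTop_nat 1)).mono_left hF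
  simpa only [add_zero] using
    le_of_tendsto_of_tendsto' hbind (hset.add hinv) fun N => timeAverage_bind_le x₀ N hS

/-- Both truncated differences of two invariant measures are invariant, and they cannot both
charge `x₀`. -/
lemma eq_of_invariant_of_forall_singleton_ne_zero [MeasurableSingletonClass X] (x₀ : X)
    (hx₀ : ∀ ρ : Measure X, IsFiniteMeasure ρ → K.Invariant ρ → ρ ≠ 0 → ρ {x₀} ≠ 0)
    {π₁ π₂ : Measure X} [IsProbabilityMeasure π₁] [IsProbabilityMeasure π₂]
    (h₁ : K.Invariant π₁) (h₂ : K.Invariant π₂) : π₁ = π₂ := by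
  wlog hle : π₁ {x₀} ≤ π₂ {x₀} generalizing π₁ π₂
  · exact (this h₂ h₁ (not_le.1 hle).le).symm
  have hx₀_sub : (π₁ - π₂) {x₀} = 0 := by
    refine Measure.sub_apply_eq_zero_of_restrict_le_restrict ?_ (measurableSet_singleton x₀)
    simp only [Measure.restrict_singleton]
    gcongr
  have hsub : π₁ - π₂ = 0 := by
    by_contra hne
    exact hx₀ _ inferInstance (sub_invariant h₁ h₂) hne hx₀_sub
  refine Measure.eq_of_le_of_measure_univ_eq ?_ (by simp)
  simpa only [zero_add] using Measure.sub_le_iff_le_add.1 hsub.le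

end MarkovChain

section Arrivals

variable {A : Fin n → Fin n → PMF ℕ} {amax : ℕ}

instance isProbabilityMeasure_arrivalLaw (A : Fin n → Fin n → PMF ℕ) :
    IsProbabilityMeasure (arrivalLaw A) := by
  unfold arrivalLaw
  infer_instance

lemma measurePreserving_arrival (A : Fin n → Fin n → PMF ℕ) (i j : Fin n) :
    MeasurePreserving (fun a : Config n => a i j) (arrivalLaw A) (A i j).toMeasure :=
  (measurePreserving_eval (fun j => (A i j).toMeasure) j).comp
    (measurePreserving_eval (fun i => Measure.pi fun j => (A i j).toMeasure) i)

lemma ae_mem_support {X : Type*} [Countable X] [MeasurableSpace X] [MeasurableSingletonClass X]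
    (p : PMF X) : ∀ᵐ x ∂p.toMeasure, x ∈ p.support := by
  rw [ae_iff, PMF.toMeasure_apply_eq_zero_iff _ .of_discrete]
  exact Set.disjoint_left.2 fun x hx hx' => hx' hx

lemma ae_arrival_mem_support (A : Fin n → Fin n → PMF ℕ) :
    ∀ᵐ a ∂arrivalLaw A, ∀ i j, a i j ∈ (A i j).support :=
  ae_all_iff.2 fun i => ae_all_iff.2 fun j =>
    (measurePreserving_arrival A i j).quasiMeasurePreserving.ae (ae_mem_support (A i j))

lemma ae_arrival_le (hA : ∀ i j, ∀ m, amax < m → A i j m = 0) :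
    ∀ᵐ a ∂arrivalLaw A, ∀ i j, a i j ≤ amax := by
  filter_upwards [ae_arrival_mem_support A] with a ha i j
  by_contra! h
  exact (PMF.mem_support_iff _ _).1 (ha i j) (hA i j _ h)

lemma finite_setOf_forall_le (B : ℕ) : {q : Config n | ∀ i j, q i j ≤ B}.Finite :=
  (Set.finite_Icc (0 : Config n) fun _ _ => B).subset fun _ hq => ⟨fun _ _ => Nat.zero_le _, hq⟩

lemma integrable_of_ae_mem_finite {X F : Type*} [Countable X] [MeasurableSpace X]
    [MeasurableSingletonClass X] [NormedAddCommGroup F] {μ : Measure X} [IsFiniteMeasure μ]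
    {S : Set X} (hS : S.Finite) (hμ : ∀ᵐ x ∂μ, x ∈ S) (f : X → F) : Integrable f μ := by
  obtain ⟨C, hC⟩ := (hS.image fun x => ‖f x‖).bddAbove
  refine Integrable.of_bound .of_discrete C ?_
  filter_upwards [hμ] with x hx using hC ⟨x, hx, rfl⟩

lemma integrable_arrival {F : Type*} [NormedAddCommGroup F]
    (hA : ∀ i j, ∀ m, amax < m → A i j m = 0) (f : Config n → F) :
    Integrable f (arrivalLaw A) :=
  integrable_of_ae_mem_finite (finite_setOf_forall_le amax) (ae_arrival_le hA) f

/-- The array of the mean numbers of arrivals in one slot. -/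
noncomputable def arrivalMean (A : Fin n → Fin n → PMF ℕ) : RVec n :=
  fun i j => ∫ m : ℕ, (m : ℝ) ∂(A i j).toMeasure

/-- The array of the variances of the numbers of arrivals in one slot. -/
noncomputable def arrivalVar (A : Fin n → Fin n → PMF ℕ) : RVec n :=
  fun i j => variance (fun m : ℕ => (m : ℝ)) (A i j).toMeasure

lemma integral_arrival_apply (A : Fin n → Fin n → PMF ℕ) (i j : Fin n) :
    ∫ a, (a i j : ℝ) ∂arrivalLaw A = arrivalMean A i j := by
  have h := measurePreserving_arrival A i j
  rw [arrivalMean, ← h.map_eq, integral_map h.aemeasurable .of_discrete]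

lemma integral_inner_arrival (hA : ∀ i j, ∀ m, amax < m → A i j m = 0) (x : Vec n) :
    ∫ a, ⟪x, natVec a⟫ ∂arrivalLaw A = ⟪x, vec (arrivalMean A)⟫ := by
  simp only [inner_eq_sum, vec_apply, natVec_apply, ← integral_arrival_apply]
  rw [integral_finsetSum _ fun i _ => integrable_arrival hA _]
  refine Finset.sum_congr rfl fun i _ => ?_
  rw [integral_finsetSum _ fun j _ => integrable_arrival hA _]
  exact Finset.sum_congr rfl fun j _ => integral_const_mul _ _

lemma integral_natVec_arrival (hA : ∀ i j, ∀ m, amax < m → A i j m = 0) :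
    ∫ a, natVec a ∂arrivalLaw A = vec (arrivalMean A) :=
  ext_inner_left ℝ fun x => by
    rw [← integral_inner (integrable_arrival hA _), integral_inner_arrival hA]

lemma iIndepFun_arrival (A : Fin n → Fin n → PMF ℕ) :
    iIndepFun (fun (e : Fin n × Fin n) (a : Config n) => (a e.1 e.2 : ℝ)) (arrivalLaw A) := by
  have h := iIndepFun_uncurry_infinitePi' (X := fun _ _ (m : ℕ) => (m : ℝ))
    (fun i j => (A i j).toMeasure) fun _ _ => .of_discrete
  simp only [Measure.infinitePi_eq_pi] at h
  exact h

lemma covariance_arrival (hA : ∀ i j, ∀ m, amax < m → A i j m = 0) (e f : Fin n × Fin n) :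
    cov[fun a => (a e.1 e.2 : ℝ), fun a => (a f.1 f.2 : ℝ); arrivalLaw A] =
      if e = f then arrivalVar A e.1 e.2 else 0 := by
  have hmem (e : Fin n × Fin n) : MemLp (fun a : Config n => (a e.1 e.2 : ℝ)) 2 (arrivalLaw A) :=
    (memLp_two_iff_integrable_sq .of_discrete).2 (integrable_arrival hA _)
  split_ifs with h
  · rw [h, covariance_self .of_discrete, arrivalVar]
    exact (measurePreserving_arrival A f.1 f.2).variance_fun_comp .of_discrete
  · exact ((iIndepFun_arrival A).indepFun h).covariance_eq_zero (hmem e) (hmem f)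

lemma integral_norm_map_arrival_sub_sq {F : Type*} [NormedAddCommGroup F] [InnerProductSpace ℝ F]
    (hA : ∀ i j, ∀ m, amax < m → A i j m = 0) (L : Vec n →L[ℝ] F) :
    ∫ a, ‖L (natVec a - vec (arrivalMean A))‖ ^ 2 ∂arrivalLaw A =
      ∑ i, ∑ j, arrivalVar A i j * ‖L (EuclideanSpace.single (i, j) 1)‖ ^ 2 := by
  have hexpand (a : Config n) : ‖L (natVec a - vec (arrivalMean A))‖ ^ 2 =
      ∑ e : Fin n × Fin n, ∑ f : Fin n × Fin n,
        ((a e.1 e.2 : ℝ) - arrivalMean A e.1 e.2) * (a f.1 f.2 - arrivalMean A f.1 f.2) *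
          ⟪L (EuclideanSpace.single e 1), L (EuclideanSpace.single f 1)⟫ := by
    rw [← (EuclideanSpace.basisFun (Fin n × Fin n) ℝ).sum_repr (natVec a - vec (arrivalMean A)),
      map_sum, ← real_inner_self_eq_norm_sq, sum_inner]
    simp only [map_smul, inner_sum, real_inner_smul_left, real_inner_smul_right,
      EuclideanSpace.basisFun_repr, EuclideanSpace.basisFun_apply, PiLp.sub_apply, vec_apply,
      natVec_apply]
    exact Finset.sum_congr rfl fun e _ => Finset.sum_congr rfl fun f _ => by ring
  have hcov (e f : Fin n × Fin n) :
      ∫ a, ((a e.1 e.2 : ℝ) - arrivalMean A e.1 e.2) * (a f.1 f.2 - arrivalMean A f.1 f.2)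
        ∂arrivalLaw A = if e = f then arrivalVar A e.1 e.2 else 0 := by
    simp only [← covariance_arrival hA, covariance, integral_arrival_apply]
  simp only [hexpand]
  rw [integral_finsetSum _ fun e _ => integrable_arrival hA _, ← Fintype.sum_prod_type']
  refine Finset.sum_congr rfl fun e _ => ?_
  rw [integral_finsetSum _ fun f _ => integrable_arrival hA _]
  simp only [integral_mul_const, hcov, ite_mul, zero_mul, Finset.sum_ite_eq, Finset.mem_univ,
    if_true, real_inner_self_eq_norm_sq]

lemma lintegral_arrival_le (hA : ∀ i j, ∀ m, amax < m → A i j m = 0) {f : Config n → ℝ}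
    (hf : ∀ a, 0 ≤ f a) {α : ℝ} {x : Vec n}
    (h : ∀ a : Config n, (∀ i j, a i j ≤ amax) → f a ≤ α + ⟪x, natVec a⟫) :
    ∫⁻ a, ENNReal.ofReal (f a) ∂arrivalLaw A ≤
      ENNReal.ofReal (α + ⟪x, vec (arrivalMean A)⟫) := by
  rw [← ofReal_integral_eq_lintegral_ofReal (integrable_arrival hA _) (ae_of_all _ hf)]
  refine ENNReal.ofReal_le_ofReal ?_
  calc ∫ a, f a ∂arrivalLaw A ≤ ∫ a, (α + ⟪x, natVec a⟫) ∂arrivalLaw A := by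
        refine integral_mono_ae (integrable_arrival hA _) (integrable_arrival hA _) ?_
        filter_upwards [ae_arrival_le hA] using h
    _ = α + ⟪x, vec (arrivalMean A)⟫ := by
        rw [integral_add (integrable_const _) (integrable_arrival hA _), integral_inner_arrival hA]
        simp

lemma arrival_zero_ne_zero (hA : ∀ i j, ∀ m, amax < m → A i j m = 0) {i j : Fin n}
    (hmean : arrivalMean A i j < 1) : A i j 0 ≠ 0 := by
  intro h₀
  refine hmean.not_ge ?_
  rw [← integral_arrival_apply]
  calc (1 : ℝ) = ∫ _, (1 : ℝ) ∂arrivalLaw A := by simp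
    _ ≤ ∫ a, (a i j : ℝ) ∂arrivalLaw A := by
      refine integral_mono_ae (integrable_const _) (integrable_arrival hA _) ?_
      filter_upwards [ae_arrival_mem_support A] with a ha
      have hne : a i j ≠ 0 := fun h => (PMF.mem_support_iff _ _).1 (ha i j) (h ▸ h₀)
      exact_mod_cast Nat.one_le_iff_ne_zero.2 hne

lemma arrivalLaw_singleton_zero (A : Fin n → Fin n → PMF ℕ) :
    arrivalLaw A {0} = ∏ i, ∏ j, A i j 0 := by
  simp only [arrivalLaw, Measure.pi_singleton, Pi.zero_apply,
    PMF.toMeasure_apply_singleton _ _ (measurableSet_singleton _)]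

end Arrivals

section QueueKernel

variable {A : Fin n → Fin n → PMF ℕ} {pol : Policy n} {amax : ℕ} {T : Set (Port n)} {η : ℝ}

instance isMarkovKernel_queueKernel (A : Fin n → Fin n → PMF ℕ) (pol : Policy n) :
    IsMarkovKernel (queueKernel A pol) :=
  ⟨fun _ => Measure.isProbabilityMeasure_map Measurable.of_discrete.aemeasurable⟩

lemma lintegral_queueKernel (A : Fin n → Fin n → PMF ℕ) (pol : Policy n) (q : Config n)
    (f : Config n → ℝ≥0∞) :
    ∫⁻ y, f y ∂queueKernel A pol q =
      ∫⁻ s, ∫⁻ a, f (nextQueue q a s) ∂arrivalLaw A ∂(pol q).toMeasure := by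
  change ∫⁻ y, f y ∂(((pol q).toMeasure.prod (arrivalLaw A)).map fun p => nextQueue q p.2 p.1) = _
  rw [lintegral_map .of_discrete .of_discrete,
    lintegral_prod _ Measurable.of_discrete.aemeasurable]

lemma lintegral_queueKernel_le (hA : ∀ i j, ∀ m, amax < m → A i j m = 0) {q : Config n}
    {f : Config n → ℝ} (hf : ∀ y, 0 ≤ f y) {α : Config n → ℝ} {x : Vec n} {c : ℝ}
    (hmajorant : ∀ s ∈ (pol q).support, ∀ a : Config n, (∀ i j, a i j ≤ amax) →
      f (nextQueue q a s) ≤ α s + ⟪x, natVec a⟫)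
    (hmean : ∀ s ∈ (pol q).support, α s + ⟪x, vec (arrivalMean A)⟫ ≤ c) :
    ∫⁻ y, ENNReal.ofReal (f y) ∂queueKernel A pol q ≤ ENNReal.ofReal c := by
  rw [lintegral_queueKernel]
  calc _ ≤ ∫⁻ _, ENNReal.ofReal c ∂(pol q).toMeasure := by
        refine lintegral_mono_ae ?_
        filter_upwards [ae_mem_support (pol q)] with s hs
        exact (lintegral_arrival_le hA (fun a => hf _) (hmajorant s hs)).trans
          (ENNReal.ofReal_le_ofReal (hmean s hs))
    _ = ENNReal.ofReal c := by simp

lemma HasConeDrift.lintegral_norm_polarPart_pow_three_le (hd : HasConeDrift T pol (arrivalMean A) η)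
    (hA : ∀ i j, ∀ m, amax < m → A i j m = 0) (hη : 0 < η) (q : Config n) :
    ∫⁻ y, ENNReal.ofReal (‖polarPart (portVec '' T) (natVec y)‖ ^ 3) ∂queueKernel A pol q +
      ENNReal.ofReal (2 * η * ‖polarPart (portVec '' T) (natVec q)‖ ^ 2) ≤
      ENNReal.ofReal (‖polarPart (portVec '' T) (natVec q)‖ ^ 3) +
        ENNReal.ofReal (driftConst (n * (amax + 1)) η) := by
  have hnext (s) (hs : s ∈ (pol q).support) (a : Config n) (ha : ∀ i j, a i j ≤ amax) :=
    norm_polarPart_nextQueue_pow_three_le (q := q) T ha (hd q s hs).1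
  have hdrift (s) (hs : s ∈ (pol q).support) :=
    cube_drift_le (c := n * (amax + 1)) (norm_nonneg _) hη (hd q s hs).2
  set x := polarPart (portVec '' T) (natVec q)
  set c : ℝ := n * (amax + 1)
  have hc : 0 ≤ driftConst c η := driftConst_nonneg (by positivity) hη.le
  rw [← ENNReal.ofReal_add (by positivity) hc]
  calc _ = ∫⁻ y, ENNReal.ofReal (‖polarPart (portVec '' T) (natVec y)‖ ^ 3 + 2 * η * ‖x‖ ^ 2)
          ∂queueKernel A pol q := by
        simp only [ENNReal.ofReal_add (pow_nonneg (norm_nonneg (polarPart _ _)) 3)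
          (by positivity : 0 ≤ 2 * η * ‖x‖ ^ 2)]
        rw [lintegral_add_right _ measurable_const, lintegral_const, measure_univ, mul_one]
    _ ≤ ENNReal.ofReal (‖x‖ ^ 3 + driftConst c η) := by
        refine lintegral_queueKernel_le hA (fun y => by positivity) (x := (3 * ‖x‖) • x)
          (α := fun s => ‖x‖ ^ 3 - 3 * ‖x‖ * ⟪x, natVec s⟫ + 3 * c ^ 2 * ‖x‖ + c ^ 3 +
            2 * η * ‖x‖ ^ 2) (fun s hs a ha => ?_) fun s hs => ?_
        · have h := hnext s hs a ha
          rw [inner_sub_right] at h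
          rw [real_inner_smul_left]
          linarith
        · have h := hdrift s hs
          rw [inner_sub_right] at h
          rw [real_inner_smul_left]
          linarith

lemma HasConeDrift.lintegral_norm_polarPart_sq_le (hd : HasConeDrift T pol (arrivalMean A) η)
    (hA : ∀ i j, ∀ m, amax < m → A i j m = 0) (hη : 0 < η) {π : Measure (Config n)}
    (hπ : IsSteadyState (queueKernel A pol) π) :
    ∫⁻ q, ENNReal.ofReal (‖polarPart (portVec '' T) (natVec q)‖ ^ 2) ∂π ≤
      ENNReal.ofReal (driftConst (n * (amax + 1)) η / (2 * η)) := by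
  have := hπ.1
  have h := lintegral_le_of_drift hπ.2 .of_discrete .of_discrete
    (fun _ => ENNReal.ofReal_ne_top) (hd.lintegral_norm_polarPart_pow_three_le hA hη)
  simp only [ENNReal.ofReal_mul (show 0 ≤ 2 * η by positivity)] at h
  rw [lintegral_const_mul _ .of_discrete] at h
  rw [ENNReal.ofReal_div_of_pos (by positivity), ENNReal.le_div_iff_mul_le (by simp [hη]) (by simp),
    mul_comm]
  exact h

lemma HasConeDrift.integrable_norm_polarPart_sq (hd : HasConeDrift T pol (arrivalMean A) η)
    (hA : ∀ i j, ∀ m, amax < m → A i j m = 0) (hη : 0 < η) {π : Measure (Config n)}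
    (hπ : IsSteadyState (queueKernel A pol) π) :
    Integrable (fun q => ‖polarPart (portVec '' T) (natVec q)‖ ^ 2) π :=
  ⟨.of_discrete, (hasFiniteIntegral_iff_ofReal (ae_of_all _ fun _ => sq_nonneg _)).2
    ((hd.lintegral_norm_polarPart_sq_le hA hη hπ).trans_lt ENNReal.ofReal_lt_top)⟩

lemma HasConeDrift.integral_norm_polarPart_sq_le (hd : HasConeDrift T pol (arrivalMean A) η)
    (hA : ∀ i j, ∀ m, amax < m → A i j m = 0) (hη : 0 < η) {π : Measure (Config n)}
    (hπ : IsSteadyState (queueKernel A pol) π) :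
    ∫ q, ‖polarPart (portVec '' T) (natVec q)‖ ^ 2 ∂π ≤
      driftConst (n * (amax + 1)) η / (2 * η) := by
  have hc : 0 ≤ driftConst (n * (amax + 1)) η := driftConst_nonneg (by positivity) hη.le
  rw [integral_eq_lintegral_of_nonneg_ae (ae_of_all _ fun _ => sq_nonneg _) .of_discrete]
  exact ENNReal.toReal_le_of_le_ofReal (by positivity) (hd.lintegral_norm_polarPart_sq_le hA hη hπ)

lemma HasConeDrift.exists_isSteadyState (hd : HasConeDrift ∅ pol (arrivalMean A) η)
    (hA : ∀ i j, ∀ m, amax < m → A i j m = 0) (hη : 0 < η) :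
    ∃ π, IsSteadyState (queueKernel A pol) π := by
  refine exists_invariant_of_drift 0 ENNReal.ofReal_ne_top ENNReal.ofReal_ne_top (fun R => ?_)
    (hd.lintegral_norm_polarPart_pow_three_le hA hη)
  obtain ⟨B, hB⟩ := exists_nat_ge √(R / (2 * η))
  refine (finite_setOf_forall_le B).subset fun q hq i j => ?_
  have hsq : 2 * η * ‖natVec q‖ ^ 2 ≤ R := by
    simpa [polarPart_empty] using ENNReal.ofReal_le_iff_le_toReal (by simp) |>.1 hq
  have hnorm : ‖natVec q‖ ≤ √(R / (2 * η)) :=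
    Real.le_sqrt_of_sq_le (by rwa [le_div_iff₀' (by positivity)])
  have hle : (q i j : ℝ) ≤ B :=
    (le_abs_self _).trans ((PiLp.norm_apply_le (natVec q) (i, j)).trans (hnorm.trans hB))
  exact_mod_cast hle

lemma weight_single (q : Config n) (i j : Fin n) :
    weight q (Pi.single i (Pi.single j 1)) = q i j := by
  rw [weight, Finset.sum_eq_single i (fun i' _ h => by simp [Pi.single_eq_of_ne h]) (by simp),
    Finset.sum_eq_single j (fun j' _ h => by simp [Pi.single_eq_of_ne h]) (by simp)]
  simp

lemma single_mem_feasibleSchedules (i j : Fin n) :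
    Pi.single i (Pi.single j 1) ∈ feasibleSchedules n := by
  refine ⟨fun i' => ?_, fun j' => ?_⟩
  · rcases eq_or_ne i' i with rfl | h
    · simp
    · simp [Pi.single_eq_of_ne h]
  · simp only [Pi.single_apply, ite_apply, Pi.zero_apply]
    simp only [Finset.sum_ite_eq', Finset.mem_univ, if_true]
    split_ifs <;> simp

lemma Policy.IsMaxWeight.sum_nextQueue_zero_lt (hpol : pol.IsMaxWeight) {q s : Config n}
    (hq : q ≠ 0) (hs : s ∈ (pol q).support) :
    ∑ i, ∑ j, nextQueue q 0 s i j < ∑ i, ∑ j, q i j := by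
  have hle (i j) : nextQueue q 0 s i j ≤ q i j := Nat.sub_le _ _
  refine (Finset.sum_le_sum fun i _ => Finset.sum_le_sum fun j _ => hle i j).lt_of_ne fun heq => ?_
  have hnext : nextQueue q 0 s = q := by
    funext i j
    have hrow := (Finset.sum_eq_sum_iff_of_le fun i _ => Finset.sum_le_sum fun j _ => hle i j).1 heq
    exact (Finset.sum_eq_sum_iff_of_le fun j _ => hle i j).1 (hrow i (Finset.mem_univ i)) j
      (Finset.mem_univ j)
  have hweight : weight q s = 0 := by
    refine Finset.sum_eq_zero fun i _ => Finset.sum_eq_zero fun j _ => ?_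
    have h : q i j + 0 - s i j = q i j := congrFun₂ hnext i j
    rcases Nat.eq_zero_or_pos (q i j) with h₀ | h₀
    · rw [h₀, zero_mul]
    · rw [show s i j = 0 by lia, mul_zero]
  refine hq (funext₂ fun i j => ?_)
  have h := (hpol q s hs).2 _ (single_mem_feasibleSchedules i j)
  rwa [weight_single, hweight, Nat.le_zero] at h

lemma queueKernel_singleton_ne_zero (hA : ∀ i j, A i j 0 ≠ 0) {q s : Config n}
    (hs : s ∈ (pol q).support) : queueKernel A pol q {nextQueue q 0 s} ≠ 0 := by
  change (((pol q).toMeasure.prod (arrivalLaw A)).map fun p => nextQueue q p.2 p.1) _ ≠ 0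
  rw [Measure.map_apply .of_discrete (measurableSet_singleton _)]
  have hsub : ({s} : Set (Config n)) ×ˢ {(0 : Config n)} ⊆
      (fun p : Config n × Config n => nextQueue q p.2 p.1) ⁻¹' {nextQueue q 0 s} := by
    rintro ⟨_, _⟩ ⟨rfl, rfl⟩
    rfl
  refine ne_of_gt (lt_of_lt_of_le ?_ (measure_mono hsub))
  rw [Measure.prod_prod, PMF.toMeasure_apply_singleton _ _ (measurableSet_singleton _),
    arrivalLaw_singleton_zero]
  exact ENNReal.mul_pos ((pol q).mem_support_iff s |>.1 hs)
    (Finset.prod_ne_zero_iff.2 fun i _ => Finset.prod_ne_zero_iff.2 fun j _ => hA i j)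

lemma Policy.IsMaxWeight.measure_singleton_zero_ne_zero (hpol : pol.IsMaxWeight)
    (hA : ∀ i j, A i j 0 ≠ 0) {ρ : Measure (Config n)} (hρ : (queueKernel A pol).Invariant ρ)
    (hne : ρ ≠ 0) : ρ {0} ≠ 0 := by
  have hdescent (N : ℕ) : ∀ q : Config n, ∑ i, ∑ j, q i j = N → ρ {q} ≠ 0 → ρ {0} ≠ 0 := by
    induction N using Nat.strong_induction_on with
    | _ N ih =>
      intro q hqN hq
      rcases eq_or_ne q 0 with rfl | hq₀
      · exact hq
      · obtain ⟨s, hs⟩ := (pol q).support_nonempty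
        exact ih _ (hqN ▸ hpol.sum_nextQueue_zero_lt hq₀ hs) _ rfl
          (measure_singleton_ne_zero_of_invariant hρ hq (queueKernel_singleton_ne_zero hA hs))
  obtain ⟨q, hq⟩ : ∃ q, ρ {q} ≠ 0 := by
    by_contra! h
    exact hne (Measure.ext_of_singleton fun q => by simp [h q])
  exact hdescent _ q rfl hq

lemma Policy.IsMaxWeight.existsUnique_isSteadyState (hpol : pol.IsMaxWeight)
    (hA : ∀ i j, ∀ m, amax < m → A i j m = 0) (hη : 0 < η)
    (hd : HasConeDrift ∅ pol (arrivalMean A) η) (hmean : ∀ i j, arrivalMean A i j < 1) :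
    ∃! π, IsSteadyState (queueKernel A pol) π := by
  obtain ⟨π, hπ⟩ := hd.exists_isSteadyState hA hη
  refine ⟨π, hπ, fun π' hπ' => ?_⟩
  have := hπ.1
  have := hπ'.1
  exact eq_of_invariant_of_forall_singleton_ne_zero 0
    (fun ρ _ hρ hne => hpol.measure_singleton_zero_ne_zero
      (fun i j => arrival_zero_ne_zero hA (hmean i j)) hρ hne) hπ'.2 hπ.2

end QueueKernel

section SingleServerQueue

variable {α β : Type*} [MeasurableSpace α] [MeasurableSpace β] {μ : Measure α} {ξ : Measure β}
  {X : α → ℕ} {Y : β → ℕ}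

lemma lintegral_natCast_eq_tsum (hX : Measurable X) :
    ∫⁻ x, (X x : ℝ≥0∞) ∂μ = ∑' l : ℕ, μ {x | l < X x} := by
  have hcast (k : ℕ) : (k : ℝ≥0∞) = ∑' l : ℕ, {l : ℕ | l < k}.indicator 1 l := by
    rw [tsum_eq_sum (s := Finset.range k) fun l hl => by simpa using hl]
    simp +contextual [← Finset.mem_range]
  have hmeas (l : ℕ) : MeasurableSet {x | l < X x} := measurableSet_lt measurable_const hX
  calc ∫⁻ x, (X x : ℝ≥0∞) ∂μ = ∫⁻ x, ∑' l : ℕ, {x | l < X x}.indicator 1 x ∂μ :=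
        lintegral_congr fun x => hcast (X x)
    _ = ∑' l : ℕ, μ {x | l < X x} := by
        rw [lintegral_tsum fun l => (measurable_one.indicator (hmeas l)).aemeasurable]
        exact tsum_congr fun l => lintegral_indicator_one (hmeas l)

lemma lintegral_natCast_sub_le (hX : Measurable X) (hY : Measurable Y)
    (h : ∀ m, ξ {y | m < Y y} ≤ μ {x | m < X x}) (m : ℕ) :
    ∫⁻ y, ((Y y - m : ℕ) : ℝ≥0∞) ∂ξ ≤ ∫⁻ x, ((X x - m : ℕ) : ℝ≥0∞) ∂μ := by
  rw [lintegral_natCast_eq_tsum (hX.sub_const m), lintegral_natCast_eq_tsum (hY.sub_const m)]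
  refine ENNReal.tsum_le_tsum fun l => ?_
  simpa only [lt_tsub_iff_right] using h (l + m)

/-- The error `[x + y - 1 - m]⁺ - [x - m]⁺ - 1_{m < x} (y - 1)` made when the convex function
`z ↦ [z - m]⁺` is replaced by its left tangent at `x`. -/
def excess (m x y : ℕ) : ℕ := if x ≤ m then x + y - 1 - m else 0

lemma measurable_excess (hX : Measurable X) (hY : Measurable Y) (m : ℕ) :
    Measurable fun z : α × β => (excess m (X z.1) (Y z.2) : ℝ≥0∞) :=
  (measurable_of_countable fun p : ℕ × ℕ => (excess m p.1 p.2 : ℝ≥0∞)).comp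
    ((hX.comp measurable_fst).prodMk (hY.comp measurable_snd))

lemma add_sub_one_sub_add_ite (m x y : ℕ) :
    x + y - 1 - m + (if m < x then 1 else 0) =
      x - m + (if m < x then 1 else 0) * y + excess m x y := by
  rw [excess]
  split_ifs <;> lia

lemma choose_two_le_tsum_excess (x y : ℕ) :
    ((y.choose 2 : ℕ) : ℝ≥0∞) ≤ ∑' m, (excess m x y : ℝ≥0∞) := by
  have hsum : ∑ m ∈ Finset.Ico x (x + y), excess m x y = y.choose 2 := by
    rw [Finset.sum_Ico_eq_sum_range, Nat.add_sub_cancel_left, Nat.choose_two_right,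
      ← Finset.sum_range_id, ← Finset.sum_range_reflect]
    refine Finset.sum_congr rfl fun l hl => ?_
    have := Finset.mem_range.1 hl
    rw [excess, if_pos (Nat.le_add_right x _)]
    lia
  rw [← hsum, Nat.cast_sum]
  exact ENNReal.sum_le_tsum _

lemma lintegral_mul_measure_add_lintegral_excess_le [IsProbabilityMeasure ξ] (hX : Measurable X)
    (hY : Measurable Y)
    (hdom : ∀ m, μ.prod ξ {z | m < X z.1 + Y z.2 - 1} ≤ μ {x | m < X x})
    (hfin : ∫⁻ x, X x ∂μ ≠ ∞) (m : ℕ) :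
    μ {x | m < X x} * ∫⁻ y, Y y ∂ξ + ∫⁻ z, excess m (X z.1) (Y z.2) ∂μ.prod ξ ≤
      μ {x | m < X x} := by
  have hexcess := measurable_excess hX hY m
  set I : α → ℝ≥0∞ := {x | m < X x}.indicator 1 with hI
  have hset : MeasurableSet {x | m < X x} := measurableSet_lt measurable_const hX
  have hIm : Measurable I := measurable_one.indicator hset
  have hIμ : ∫⁻ x, I x ∂μ = μ {x | m < X x} := lintegral_indicator_one hset
  have hIprod : ∫⁻ z, I z.1 * Y z.2 ∂μ.prod ξ = μ {x | m < X x} * ∫⁻ y, Y y ∂ξ := by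
    rw [lintegral_prod_mul (g := fun y => (Y y : ℝ≥0∞)) hIm.aemeasurable (by fun_prop), hIμ]
  have hfst {f : α → ℝ≥0∞} (hf : Measurable f) : ∫⁻ z, f z.1 ∂μ.prod ξ = ∫⁻ x, f x ∂μ :=
    measurePreserving_fst.lintegral_comp hf
  have hne : ∫⁻ x, ((X x - m : ℕ) : ℝ≥0∞) ∂μ ≠ ∞ :=
    ne_top_of_le_ne_top hfin (lintegral_mono fun x => Nat.cast_le.2 (Nat.sub_le _ _))
  refine (ENNReal.add_le_add_iff_left hne).1 ?_
  calc _ = ∫⁻ z, (((X z.1 - m : ℕ) : ℝ≥0∞) + I z.1 * Y z.2 + excess m (X z.1) (Y z.2))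
          ∂μ.prod ξ := by
        rw [lintegral_add_right _ (by fun_prop), lintegral_add_right _ (by fun_prop), hIprod,
          hfst (f := fun x => ((X x - m : ℕ) : ℝ≥0∞)) (by fun_prop), add_assoc]
    _ = ∫⁻ z, (((X z.1 + Y z.2 - 1 - m : ℕ) : ℝ≥0∞) + I z.1) ∂μ.prod ξ := by
        refine lintegral_congr fun z => ?_
        have h := congrArg (Nat.cast (R := ℝ≥0∞)) (add_sub_one_sub_add_ite m (X z.1) (Y z.2))
        simpa [hI, Set.indicator_apply] using h.symm
    _ ≤ _ := by
        rw [lintegral_add_right _ (by fun_prop), hfst hIm, hIμ]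
        gcongr
        exact lintegral_natCast_sub_le hX (by fun_prop) hdom m

/-- Testing the stochastic domination by a queue with unit service against all functions
`z ↦ [z - m]⁺` and adding up the excesses gives one half of the Pollaczek-Khinchine formula. -/
lemma lintegral_choose_two_add_le [IsProbabilityMeasure μ] [IsProbabilityMeasure ξ]
    (hX : Measurable X) (hY : Measurable Y)
    (hdom : ∀ m, μ.prod ξ {z | m < X z.1 + Y z.2 - 1} ≤ μ {x | m < X x}) :
    ∫⁻ y, ((Y y).choose 2 : ℕ) ∂ξ + (∫⁻ x, X x ∂μ) * ∫⁻ y, Y y ∂ξ ≤ ∫⁻ x, X x ∂μ := by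
  rcases eq_or_ne (∫⁻ x, (X x : ℝ≥0∞) ∂μ) ∞ with htop | hfin
  · simp [htop]
  have hchoose : ∫⁻ y, ((Y y).choose 2 : ℕ) ∂ξ ≤
      ∑' m, ∫⁻ z, excess m (X z.1) (Y z.2) ∂μ.prod ξ := by
    rw [← lintegral_tsum fun m => (measurable_excess hX hY m).aemeasurable]
    calc _ = ∫⁻ z, ((Y z.2).choose 2 : ℕ) ∂μ.prod ξ :=
          (measurePreserving_snd.lintegral_comp (f := fun y => (((Y y).choose 2 : ℕ) : ℝ≥0∞))
            ((measurable_of_countable fun k : ℕ => ((k.choose 2 : ℕ) : ℝ≥0∞)).comp hY)).symm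
      _ ≤ _ := lintegral_mono fun z => choose_two_le_tsum_excess _ _
  calc _ ≤ ∑' m, (μ {x | m < X x} * ∫⁻ y, Y y ∂ξ +
          ∫⁻ z, excess m (X z.1) (Y z.2) ∂μ.prod ξ) := by
        rw [ENNReal.tsum_add, ENNReal.tsum_mul_right, ← lintegral_natCast_eq_tsum hX, add_comm]
        gcongr
    _ ≤ ∑' m, μ {x | m < X x} := ENNReal.tsum_le_tsum
        (lintegral_mul_measure_add_lintegral_excess_le hX hY hdom hfin)
    _ = _ := (lintegral_natCast_eq_tsum hX).symm

lemma integral_choose_two [IsProbabilityMeasure ξ] (hY : MemLp (fun y => (Y y : ℝ)) 2 ξ) :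
    ∫ y, ((Y y).choose 2 : ℝ) ∂ξ =
      (Var[fun y => (Y y : ℝ); ξ] + (∫ y, (Y y : ℝ) ∂ξ) ^ 2 - ∫ y, (Y y : ℝ) ∂ξ) / 2 := by
  have hint := hY.integrable one_le_two
  simp only [variance_eq_sub hY, sub_add_cancel, Pi.pow_apply]
  rw [← integral_sub hY.integrable_sq hint, ← integral_div]
  refine integral_congr_ae (ae_of_all _ fun y => ?_)
  simp only [Nat.cast_choose_two]
  ring

lemma ofReal_div_le_lintegral [IsProbabilityMeasure μ] [IsProbabilityMeasure ξ]
    (hX : Measurable X) (hY : Measurable Y) (hYmem : MemLp (fun y => (Y y : ℝ)) 2 ξ)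
    (hdom : ∀ m, μ.prod ξ {z | m < X z.1 + Y z.2 - 1} ≤ μ {x | m < X x}) {κ : ℝ} (hκ : 0 < κ)
    (hmean : ∫ y, (Y y : ℝ) ∂ξ = 1 - κ) :
    ENNReal.ofReal ((Var[fun y => (Y y : ℝ); ξ] - κ) / (2 * κ)) ≤ ∫⁻ x, X x ∂μ := by
  rcases eq_or_ne (∫⁻ x, (X x : ℝ≥0∞) ∂μ) ∞ with htop | hfin
  · simp [htop]
  have hmain := lintegral_choose_two_add_le hX hY hdom
  set c := (∫⁻ x, (X x : ℝ≥0∞) ∂μ).toReal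
  have hc₀ : 0 ≤ c := ENNReal.toReal_nonneg
  have hmean₀ : 0 ≤ 1 - κ := hmean ▸ integral_nonneg fun y => Nat.cast_nonneg _
  have hYint := hYmem.integrable one_le_two
  have hEY : ∫⁻ y, (Y y : ℝ≥0∞) ∂ξ = ENNReal.ofReal (1 - κ) := by
    rw [← hmean, ofReal_integral_eq_lintegral_ofReal hYint (ae_of_all _ fun y => Nat.cast_nonneg _)]
    simp only [ENNReal.ofReal_natCast]
  have hEchoose : ENNReal.ofReal (∫ y, ((Y y).choose 2 : ℝ) ∂ξ) ≤
      ∫⁻ y, ((Y y).choose 2 : ℕ) ∂ξ := by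
    rw [← Real.enorm_of_nonneg (integral_nonneg fun y => Nat.cast_nonneg _)]
    simpa using enorm_integral_le_lintegral_enorm (μ := ξ) fun y => ((Y y).choose 2 : ℝ)
  have hreal : ∫ y, ((Y y).choose 2 : ℝ) ∂ξ + c * (1 - κ) ≤ c := by
    rw [← ENNReal.ofReal_le_ofReal_iff hc₀, ENNReal.ofReal_add (integral_nonneg fun y =>
      Nat.cast_nonneg _) (by positivity), ENNReal.ofReal_mul hc₀, ENNReal.ofReal_toReal hfin, ← hEY]
    exact (by gcongr : _ ≤ _).trans hmain
  rw [integral_choose_two hYmem, hmean] at hreal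
  refine ENNReal.ofReal_le_of_le_toReal ((div_le_iff₀ (by positivity)).2 ?_)
  nlinarith [sq_nonneg κ]

end SingleServerQueue

section StablePolicy

variable {A : Fin n → Fin n → PMF ℕ} {amax : ℕ}

lemma memLp_weight_arrival (hA : ∀ i j, ∀ m, amax < m → A i j m = 0) (c : Config n) :
    MemLp (fun a => (weight c a : ℝ)) 2 (arrivalLaw A) :=
  (memLp_two_iff_integrable_sq .of_discrete).2 (integrable_arrival hA _)

lemma integral_weight_portConfig_arrival (hA : ∀ i j, ∀ m, amax < m → A i j m = 0) (p : Port n) :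
    ∫ a, (weight (portConfig p) a : ℝ) ∂arrivalLaw A = portSum (arrivalMean A) p := by
  simp only [← inner_portVec_natVec, integral_inner_arrival hA, inner_portVec_vec]

lemma variance_weight_portConfig_arrival (hA : ∀ i j, ∀ m, amax < m → A i j m = 0) (p : Port n) :
    Var[fun a => (weight (portConfig p) a : ℝ); arrivalLaw A] = portSum (arrivalVar A) p := by
  have h := integral_norm_map_arrival_sub_sq hA (innerSL ℝ (portVec p))
  simp only [innerSL_apply_apply, inner_sub_right, inner_portVec_natVec, inner_portVec_vec,
    Real.norm_eq_abs, sq_abs] at h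
  rw [variance_eq_integral .of_discrete, integral_weight_portConfig_arrival hA, h]
  rcases p with l | l
  · simp [inner_portVec_inl_single, portSum, rowSum]
  · simp [inner_portVec_inr_single, portSum, colSum]

lemma weight_add_weight_sub_one_le_weight_nextQueue {s : Config n} (hs : s ∈ feasibleSchedules n)
    (p : Port n) (q a : Config n) :
    weight (portConfig p) q + weight (portConfig p) a - 1 ≤
      weight (portConfig p) (nextQueue q a s) := by
  have h : (weight (portConfig p) (nextQueue q a s) : ℝ) =
      weight (portConfig p) q + (weight (portConfig p) a - weight (portConfig p) s +
        weight (portConfig p) (unusedService q a s)) := by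
    simp only [← inner_portVec_natVec, ← inner_add_right, ← inner_sub_right, natVec_nextQueue]
  have h' : weight (portConfig p) (nextQueue q a s) + weight (portConfig p) s =
      weight (portConfig p) q + weight (portConfig p) a +
        weight (portConfig p) (unusedService q a s) := by
    rify
    linarith
  have := mem_feasibleSchedules_iff.1 hs p
  lia

lemma sum_lintegral_weight_le_meanTotal {π : Measure (Config n)} {S : Finset (Port n)}
    (hS : ∀ i j, ∑ p ∈ S, portConfig p i j ≤ 1) :
    ∑ p ∈ S, ∫⁻ x, weight (portConfig p) x ∂π ≤ meanTotal π := by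
  rw [← lintegral_finsetSum _ fun p _ => .of_discrete]
  refine lintegral_mono fun x => ?_
  rw [← Nat.cast_sum, Nat.cast_le]
  simp only [weight]
  rw [Finset.sum_comm]
  refine Finset.sum_le_sum fun i _ => ?_
  rw [Finset.sum_comm]
  refine Finset.sum_le_sum fun j _ => ?_
  rw [← Finset.sum_mul]
  exact mul_le_of_le_one_left (Nat.zero_le _) (hS i j)

lemma continuous_portSum (p : Port n) : Continuous fun x : RVec n => portSum x p := by
  rcases p with i | j
  · simp only [portSum, Sum.elim_inl, rowSum]
    fun_prop
  · simp only [portSum, Sum.elim_inr, colSum]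
    fun_prop

variable {Ω : Type*} [mΩ : MeasurableSpace Ω] {P : Measure Ω} [IsProbabilityMeasure P]
  {ℱ : Filtration ℕ mΩ} {a s q : ℕ → Ω → Config n} {π : Measure (Config n)}
  [IsProbabilityMeasure π]

lemma tendsto_prod_measure_of_isClopen {ι E F : Type*} {l : Filter ι}
    [TopologicalSpace E] [TopologicalSpace F] [TopologicalSpace.PseudoMetrizableSpace E]
    [TopologicalSpace.PseudoMetrizableSpace F]
    [SecondCountableTopology E] [SecondCountableTopology F] [MeasurableSpace E]
    [MeasurableSpace F] [OpensMeasurableSpace E] [OpensMeasurableSpace F]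
    {ρ : ι → ProbabilityMeasure E} {ρ' : ProbabilityMeasure E} (hρ : Tendsto ρ l (𝓝 ρ'))
    (ξ : ProbabilityMeasure F) {S : Set (E × F)} (hS : IsClopen S) :
    Tendsto (fun i => (ρ i : Measure E).prod ξ S) l (𝓝 ((ρ' : Measure E).prod ξ S)) :=
  ProbabilityMeasure.tendsto_measure_of_null_frontier_of_tendsto'
    ((ProbabilityMeasure.continuous_prod.tendsto (ρ', ξ)).comp
      (hρ.prodMk_nhds tendsto_const_nhds)) (by simp [hS.frontier_eq])

lemma IsSwitchProcess.map_queue_arrival (h : IsSwitchProcess P A ℱ a s q) (t : ℕ) :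
    P.map (fun ω => (q t ω, a t ω)) = (P.map (q t)).prod (arrivalLaw A) := by
  have hq : Measurable (q t) := (h.queue_meas t).mono (ℱ.le t) le_rfl
  have ha : Measurable (a t) := (h.arrivals_meas t).mono (ℱ.le (t + 1)) le_rfl
  have hindep : IndepFun (q t) (a t) P := (IndepFun_iff_Indep _ _ _).2
    (indep_of_indep_of_le_right (h.arrivals_indep t) (h.queue_meas t).comap_le).symm
  rw [(indepFun_iff_map_prod_eq_prod_map_map hq.aemeasurable ha.aemeasurable).1 hindep,
    h.arrivals_law]

lemma IsSwitchProcess.prod_weight_add_sub_one_le (h : IsSwitchProcess P A ℱ a s q)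
    (hlim : TendstoInDistribution q atTop id (fun _ => P) π) (p : Port n) (m : ℕ) :
    π.prod (arrivalLaw A)
        {z | m < weight (portConfig p) z.1 + weight (portConfig p) z.2 - 1} ≤
      π {x | m < weight (portConfig p) x} := by
  set E : Set (Config n × Config n) :=
    {z | m < weight (portConfig p) z.1 + weight (portConfig p) z.2 - 1}
  have hq (t : ℕ) : AEMeasurable (q t) P := hlim.forall_aemeasurable t
  have hπ := hlim.tendsto
  simp only [Measure.map_id] at hπ
  let ξ : ProbabilityMeasure (Config n) := ⟨arrivalLaw A, inferInstance⟩
  refine le_of_tendsto_of_tendsto' (tendsto_prod_measure_of_isClopen hπ ξ (isClopen_discrete E))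
    ((ProbabilityMeasure.tendsto_measure_of_null_frontier_of_tendsto' hπ
      (E := {x | m < weight (portConfig p) x}) (by simp)).comp (tendsto_add_atTop_nat 1))
    fun t => ?_
  change (P.map (q t)).prod (arrivalLaw A) E ≤ P.map (q (t + 1)) _
  have ha : Measurable (a t) := (h.arrivals_meas t).mono (ℱ.le (t + 1)) le_rfl
  rw [← h.map_queue_arrival, Measure.map_apply_of_aemeasurable ((hq t).prodMk ha.aemeasurable)
    .of_discrete, Measure.map_apply_of_aemeasurable (hq _) .of_discrete]
  refine measure_mono fun ω hω => ?_
  have hnext := weight_add_weight_sub_one_le_weight_nextQueue (h.schedule_mem t ω) p (q t ω) (a t ω)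
  rw [← h.evolve] at hnext
  exact hω.trans_le hnext

lemma IsSwitchProcess.ofReal_div_le_lintegral_weight (h : IsSwitchProcess P A ℱ a s q)
    (hlim : TendstoInDistribution q atTop id (fun _ => P) π)
    (hA : ∀ i j, ∀ m, amax < m → A i j m = 0) {p : Port n} {κ : ℝ} (hκ : 0 < κ)
    (hmean : portSum (arrivalMean A) p = 1 - κ) :
    ENNReal.ofReal ((portSum (arrivalVar A) p - κ) / (2 * κ)) ≤
      ∫⁻ x, weight (portConfig p) x ∂π := by
  rw [← variance_weight_portConfig_arrival hA]
  exact ofReal_div_le_lintegral .of_discrete .of_discrete (memLp_weight_arrival hA _)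
    (h.prod_weight_add_sub_one_le hlim p) hκ
    ((integral_weight_portConfig_arrival hA p).trans hmean)

end StablePolicy

section StablePolicyHeavyTraffic

variable {Ω : ℝ → Type*} [mΩ : ∀ ε, MeasurableSpace (Ω ε)] {P : ∀ ε, Measure (Ω ε)}
  [∀ ε, IsProbabilityMeasure (P ε)] {ℱ : ∀ ε, Filtration ℕ (mΩ ε)}
  {a s q : ∀ ε, ℕ → Ω ε → Config n} {π : ℝ → Measure (Config n)}
  [∀ ε, IsProbabilityMeasure (π ε)] {A : ℝ → Fin n → Fin n → PMF ℕ} {amax : ℕ} {ε₀ : ℝ}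
  {ν k τ : RVec n}

lemma ofReal_sum_le_liminf_meanTotal {S : Finset (Port n)}
    (hS : ∀ i j, ∑ p ∈ S, portConfig p i j ≤ 1) (hν : ∀ p ∈ S, portSum ν p = 1)
    (hk : ∀ p ∈ S, 0 < portSum k p) (hε₀ : 0 < ε₀)
    (hA : ∀ ε ∈ Set.Ioo 0 ε₀, ∀ i j, ∀ m, amax < m → A ε i j m = 0)
    (hmean : ∀ ε ∈ Set.Ioo 0 ε₀, arrivalMean (A ε) = ν - ε • k)
    (hvar : Tendsto (fun ε => arrivalVar (A ε)) (𝓝[>] 0) (𝓝 τ))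
    (h : ∀ ε ∈ Set.Ioo 0 ε₀, IsSwitchProcess (P ε) (A ε) (ℱ ε) (a ε) (s ε) (q ε) ∧
      TendstoInDistribution (q ε) atTop id (fun _ => P ε) (π ε)) :
    ENNReal.ofReal (∑ p ∈ S, portSum τ p / (2 * portSum k p)) ≤
      liminf (fun ε => ENNReal.ofReal ε * meanTotal (π ε)) (𝓝[>] 0) := by
  let bound (ε : ℝ) : ℝ :=
    ∑ p ∈ S, (portSum (arrivalVar (A ε)) p - ε * portSum k p) / (2 * portSum k p)
  have hbound : Tendsto bound (𝓝[>] 0) (𝓝 (∑ p ∈ S, portSum τ p / (2 * portSum k p))) := by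
    refine tendsto_finsetSum _ fun p _ => Tendsto.div_const ?_ _
    have hε : Tendsto (fun ε : ℝ => ε * portSum k p) (𝓝[>] 0) (𝓝 0) :=
      (continuous_mul_const (portSum k p)).tendsto' 0 0 (zero_mul _) |>.mono_left
        nhdsWithin_le_nhds
    simpa using (((continuous_portSum p).tendsto τ).comp hvar).sub hε
  rw [← ((ENNReal.continuous_ofReal.tendsto _).comp hbound).liminf_eq]
  refine liminf_le_liminf ?_
  filter_upwards [Ioo_mem_nhdsGT hε₀] with ε hε
  have hport (p : Port n) (hp : p ∈ S) := (h ε hε).1.ofReal_div_le_lintegral_weight (h ε hε).2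
    (hA ε hε) (p := p) (mul_pos hε.1 (hk p hp)) <| by
      rw [hmean ε hε, sub_eq_add_neg, ← neg_smul, portSum_add_smul, hν p hp, neg_mul,
        ← sub_eq_add_neg]
  calc ENNReal.ofReal (bound ε) = ENNReal.ofReal ε * ENNReal.ofReal (∑ p ∈ S,
        (portSum (arrivalVar (A ε)) p - ε * portSum k p) / (2 * (ε * portSum k p))) := by
        rw [← ENNReal.ofReal_mul hε.1.le, Finset.mul_sum]
        congr! 2 with p hp
        have := (hk p hp).ne'
        have := hε.1.ne'
        field_simp
    _ ≤ ENNReal.ofReal ε * ∑ p ∈ S, ∫⁻ x, weight (portConfig p) x ∂π ε := by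
        gcongr
        exact (Finset.le_sum_of_subadditive _ ENNReal.ofReal_zero.le
          (fun _ _ => ENNReal.ofReal_add_le) _ _).trans (Finset.sum_le_sum hport)
    _ ≤ ENNReal.ofReal ε * meanTotal (π ε) := by
        gcongr
        exact sum_lintegral_weight_le_meanTotal hS

lemma sum_portSum_div_eq_half_dot_zetaRow (n₁ : ℕ) (τ k : RVec n) :
    ∑ p ∈ (Finset.univ.filter fun i : Fin n => (i : ℕ) < n₁).map .inl,
      portSum τ p / (2 * portSum k p) = 1 / 2 * dot τ (zetaRow n₁ k) := by
  rw [Finset.sum_map, Finset.sum_filter, dot, Finset.mul_sum]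
  refine Finset.sum_congr rfl fun i _ => ?_
  by_cases hi : (i : ℕ) < n₁
  · simp only [zetaRow, if_pos hi, ← Finset.sum_mul, portSum, Function.Embedding.inl_apply,
      Sum.elim_inl, rowSum]
    ring
  · simp [zetaRow, hi]

lemma sum_portSum_div_eq_half_dot_zetaCol (n₂ : ℕ) (τ k : RVec n) :
    ∑ p ∈ (Finset.univ.filter fun j : Fin n => (j : ℕ) < n₂).map .inr,
      portSum τ p / (2 * portSum k p) = 1 / 2 * dot τ (zetaCol n₂ k) := by
  rw [Finset.sum_map, Finset.sum_filter, dot, Finset.sum_comm, Finset.mul_sum]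
  refine Finset.sum_congr rfl fun j _ => ?_
  by_cases hj : (j : ℕ) < n₂
  · simp only [zetaCol, if_pos hj, ← Finset.sum_mul, portSum, Function.Embedding.inr_apply,
      Sum.elim_inr, colSum]
    ring
  · simp [zetaCol, hj]

theorem ofReal_half_max_le_liminf_meanTotal {n₁ n₂ : ℕ}
    (hν : ∀ p ∈ saturated n n₁ n₂, portSum ν p = 1)
    (hk : ∀ p ∈ saturated n n₁ n₂, 0 < portSum k p) (hε₀ : 0 < ε₀)
    (hA : ∀ ε ∈ Set.Ioo 0 ε₀, ∀ i j, ∀ m, amax < m → A ε i j m = 0)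
    (hmean : ∀ ε ∈ Set.Ioo 0 ε₀, arrivalMean (A ε) = ν - ε • k)
    (hvar : Tendsto (fun ε => arrivalVar (A ε)) (𝓝[>] 0) (𝓝 τ))
    (h : ∀ ε ∈ Set.Ioo 0 ε₀, IsSwitchProcess (P ε) (A ε) (ℱ ε) (a ε) (s ε) (q ε) ∧
      TendstoInDistribution (q ε) atTop id (fun _ => P ε) (π ε)) :
    ENNReal.ofReal (1 / 2 * max (dot τ (zetaRow n₁ k)) (dot τ (zetaCol n₂ k))) ≤
      liminf (fun ε => ENNReal.ofReal ε * meanTotal (π ε)) (𝓝[>] 0) := by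
  have hbound {S : Finset (Port n)} (hsub : ∀ p ∈ S, p ∈ saturated n n₁ n₂)
      (hS : ∀ i j, ∑ p ∈ S, portConfig p i j ≤ 1) :=
    ofReal_sum_le_liminf_meanTotal hS (fun p hp => hν p (hsub p hp))
      (fun p hp => hk p (hsub p hp)) hε₀ hA hmean hvar h
  rw [mul_max_of_nonneg _ _ (by norm_num), ← sum_portSum_div_eq_half_dot_zetaRow,
    ← sum_portSum_div_eq_half_dot_zetaCol, (Monotone.map_max fun _ _ => ENNReal.ofReal_le_ofReal)]
  refine max_le (hbound (by simp) fun i j => ?_) (hbound (by simp) fun i j => ?_) <;>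
  · simp only [Finset.sum_map, portConfig, Function.Embedding.inl_apply,
      Function.Embedding.inr_apply, Finset.sum_ite_eq]
    split_ifs <;> simp

end StablePolicyHeavyTraffic

section StationarySlot

/-- The queue lengths `q`, the schedule `s` and the arrivals `a` of one time slot of a switch in
steady state: the queue lengths have the same law `π` at the beginning of the slot and after it. -/
structure IsStationarySlot {Ω : Type*} [MeasurableSpace Ω] (P : Measure Ω)
    (A : Fin n → Fin n → PMF ℕ) (π : Measure (Config n)) (q s a : Ω → Config n) : Prop where
  queue : MeasurePreserving q P π
  next : MeasurePreserving (fun ω => nextQueue (q ω) (a ω) (s ω)) P π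
  arrivals : MeasurePreserving a P (arrivalLaw A)
  schedule_meas : Measurable s
  indep : IndepFun q a P
  schedule_mem : ∀ᵐ ω ∂P, s ω ∈ maximalSchedules n

/-- The scheduling rule `pol` as a kernel from queue lengths to schedules. -/
noncomputable def policyKernel (pol : Policy n) : Kernel (Config n) (Config n) :=
  Kernel.ofFunOfCountable fun q => (pol q).toMeasure

instance isMarkovKernel_policyKernel (pol : Policy n) : IsMarkovKernel (policyKernel pol) :=
  ⟨fun q => inferInstanceAs (IsProbabilityMeasure (pol q).toMeasure)⟩

lemma IsSteadyState.isStationarySlot {A : Fin n → Fin n → PMF ℕ} {pol : Policy n}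
    {π : Measure (Config n)} (hπ : IsSteadyState (queueKernel A pol) π)
    (hpol : ∀ q, ∀ s ∈ (pol q).support, s ∈ maximalSchedules n) :
    IsStationarySlot ((π ⊗ₘ policyKernel pol).prod (arrivalLaw A)) A π
      (fun ω => ω.1.1) (fun ω => ω.1.2) (fun ω => ω.2) where
  queue := by
    have := hπ.1
    have hfst : MeasurePreserving Prod.fst (π ⊗ₘ policyKernel pol) π :=
      ⟨measurable_fst, Measure.fst_compProd π (policyKernel pol)⟩
    exact hfst.comp measurePreserving_fst
  next := by
    have := hπ.1
    refine ⟨.of_discrete, Measure.ext_of_lintegral _ fun f hf => ?_⟩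
    rw [lintegral_map hf .of_discrete, lintegral_prod _ Measurable.of_discrete.aemeasurable,
      Measure.lintegral_compProd .of_discrete, ← lintegral_lintegral_of_invariant hπ.2 hf]
    refine lintegral_congr fun q => ?_
    rw [lintegral_queueKernel]
    rfl
  arrivals := by
    have := hπ.1
    exact measurePreserving_snd
  schedule_meas := .of_discrete
  indep := by
    have := hπ.1
    exact indepFun_prod (X := fun x : Config n × Config n => x.1) (Y := id)
      measurable_fst measurable_id
  schedule_mem := by
    have := hπ.1
    have h : ∀ᵐ x ∂(π ⊗ₘ policyKernel pol), x.2 ∈ maximalSchedules n :=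
      Measure.ae_compProd_of_ae_ae .of_discrete <| ae_of_all _ fun q =>
        (ae_mem_support (pol q)).mono fun s hs => hpol q s hs
    exact Measure.quasiMeasurePreserving_fst.ae h

lemma integral_comp_of_measurePreserving {Ω X : Type*} [MeasurableSpace Ω] [MeasurableSpace X]
    [DiscreteMeasurableSpace X] [Countable X] {E : Type*} [NormedAddCommGroup E] [NormedSpace ℝ E]
    {P : Measure Ω} {π : Measure X} {g : Ω → X} (hg : MeasurePreserving g P π) (f : X → E) :
    ∫ ω, f (g ω) ∂P = ∫ x, f x ∂π := by
  rw [← hg.map_eq, integral_map hg.measurable.aemeasurable .of_discrete]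

lemma integrable_inner_of_memLp {Ω F : Type*} [MeasurableSpace Ω] {P : Measure Ω}
    [NormedAddCommGroup F] [InnerProductSpace ℝ F] {X Y : Ω → F} (hX : MemLp X 2 P)
    (hY : MemLp Y 2 P) : Integrable (fun ω => ⟪X ω, Y ω⟫) P :=
  (hX.norm.integrable_mul hY.norm).mono' (hX.1.inner hY.1)
    (ae_of_all _ fun _ => norm_inner_le_norm _ _)

/-- The contribution of the unused service to the increment of `‖portProj T q‖ ^ 2` in one slot. -/
noncomputable def unusedServiceEffect (T : Set (Port n)) (q a s : Config n) : ℝ :=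
  2 * ⟪portProj T (natVec (nextQueue q a s)), natVec (unusedService q a s)⟫ -
    ‖portProj T (natVec (unusedService q a s))‖ ^ 2

lemma norm_portProj_nextQueue_sq {T : Set (Port n)} {lam k : RVec n} {ε : ℝ}
    (hlam : ∀ p ∈ T, portSum lam p = 1 - ε * portSum k p) {q a s : Config n}
    (hs : s ∈ maximalSchedules n) :
    ‖portProj T (natVec (nextQueue q a s))‖ ^ 2 =
      ‖portProj T (natVec q)‖ ^ 2 - 2 * ε * ⟪portProj T (natVec q), vec k⟫ +
        ‖portProj T (natVec a - vec lam)‖ ^ 2 + ε ^ 2 * ‖portProj T (vec k)‖ ^ 2 +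
        2 * ⟪portProj T (natVec q) - ε • portProj T (vec k), natVec a - vec lam⟫ +
        unusedServiceEffect T q a s := by
  have hproj : portProj T (natVec s) = portProj T (vec (lam + ε • k)) :=
    portProj_eq_of_forall_inner_eq fun p hp => by
      rw [inner_portVec_natVec, inner_portVec_vec, mem_maximalSchedules_iff.1 hs p,
        portSum_add_smul, hlam p hp]
      simp
  have hnext : portProj T (natVec (nextQueue q a s)) - portProj T (natVec (unusedService q a s)) =
      portProj T (natVec q) - ε • portProj T (vec k) + portProj T (natVec a - vec lam) := by
    rw [natVec_nextQueue, map_add, map_add, map_sub, hproj]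
    simp only [map_add, map_sub, map_smul]
    abel
  have hsq := congr_arg (‖·‖ ^ 2) hnext
  simp only [norm_sub_sq_real, norm_add_sq_real, inner_sub_left, real_inner_smul_left,
    real_inner_smul_right, inner_portProj_portProj, norm_smul, Real.norm_eq_abs, mul_pow,
    sq_abs] at hsq
  rw [unusedServiceEffect]
  simp only [inner_sub_left, real_inner_smul_left]
  linarith

lemma abs_inner_portProj_nextQueue_unusedService_le (T : Set (Port n)) (q a s : Config n) :
    |⟪portProj T (natVec (nextQueue q a s)), natVec (unusedService q a s)⟫| ≤
      ‖polarPart (portVec '' T) (natVec (nextQueue q a s))‖ *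
        ‖coveredPart T (natVec (unusedService q a s))‖ := by
  have horth : ⟪natVec (nextQueue q a s), coveredPart T (natVec (unusedService q a s))⟫ = 0 := by
    rw [inner_eq_sum]
    refine Finset.sum_eq_zero fun i _ => Finset.sum_eq_zero fun j _ => ?_
    have h := congr_arg ((↑) : ℕ → ℝ) (nextQueue_mul_unusedService q a s i j)
    push_cast at h
    by_cases he : .inl i ∈ T ∨ .inr j ∈ T
    · simpa [coveredPart, natVec_apply, he] using h
    · simp [coveredPart, he]
  rw [← inner_portProj_coveredPart, ← sub_zero ⟪portProj T _, _⟫, ← horth, ← inner_sub_left]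
  refine (abs_real_inner_le_norm _ _).trans (mul_le_mul_of_nonneg_right ?_ (norm_nonneg _))
  rw [norm_sub_rev]
  exact norm_sub_starProjection_span_le _ _

lemma abs_unusedServiceEffect_le (T : Set (Port n)) (q a s : Config n) {r : ℝ} (hr : 0 < r) :
    |unusedServiceEffect T q a s| ≤
      r * ‖polarPart (portVec '' T) (natVec (nextQueue q a s))‖ ^ 2 +
        (1 + r⁻¹) * ‖coveredPart T (natVec (unusedService q a s))‖ ^ 2 := by
  set x := ‖polarPart (portVec '' T) (natVec (nextQueue q a s))‖
  set y := ‖coveredPart T (natVec (unusedService q a s))‖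
  have hproj : ‖portProj T (natVec (unusedService q a s))‖ ^ 2 ≤ y ^ 2 := by
    rw [← portProj_coveredPart]
    exact pow_le_pow_left₀ (norm_nonneg _) (norm_portProj_le _ _) 2
  have hamgm : 2 * (x * y) ≤ r * x ^ 2 + r⁻¹ * y ^ 2 := by
    have h : r * x ^ 2 + r⁻¹ * y ^ 2 - 2 * (x * y) = r⁻¹ * (r * x - y) ^ 2 := by
      field_simp
      ring
    linarith [mul_nonneg (inv_nonneg.2 hr.le) (sq_nonneg (r * x - y))]
  calc |unusedServiceEffect T q a s| ≤ |2 * ⟪_, _⟫| + |‖_‖ ^ 2| := abs_sub _ _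
    _ ≤ 2 * (x * y) + y ^ 2 := by
      rw [abs_mul, abs_two, abs_of_nonneg (sq_nonneg ‖_‖)]
      gcongr
      exact abs_inner_portProj_nextQueue_unusedService_le T q a s
    _ ≤ _ := by linarith

namespace IsStationarySlot

variable {Ω : Type*} [MeasurableSpace Ω] {P : Measure Ω}
  {A : Fin n → Fin n → PMF ℕ} {amax : ℕ} {π : Measure (Config n)} {q s a : Ω → Config n}
  {T : Set (Port n)}

lemma ae_unusedService_le_one (h : IsStationarySlot P A π q s a) :
    ∀ᵐ ω ∂P, ∀ i j, unusedService (q ω) (a ω) (s ω) i j ≤ 1 :=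
  h.schedule_mem.mono fun _ hs =>
    unusedService_le_one (maximalSchedules_subset_feasibleSchedules hs)

lemma measurable_unusedService (h : IsStationarySlot P A π q s a) :
    Measurable fun ω => unusedService (q ω) (a ω) (s ω) :=
  (Measurable.of_discrete (f := fun x : Config n × Config n × Config n =>
    unusedService x.1 x.2.1 x.2.2)).comp
    (h.queue.measurable.prodMk (h.arrivals.measurable.prodMk h.schedule_meas))

lemma memLp_queue (h : IsStationarySlot P A π q s a) (hπ : MemLp natVec 2 π) :
    MemLp (fun ω => natVec (q ω)) 2 P :=
  hπ.comp_measurePreserving h.queue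

lemma memLp_next (h : IsStationarySlot P A π q s a) (hπ : MemLp natVec 2 π) :
    MemLp (fun ω => natVec (nextQueue (q ω) (a ω) (s ω))) 2 P :=
  hπ.comp_measurePreserving h.next

lemma integral_next (h : IsStationarySlot P A π q s a) (f : Config n → ℝ) :
    ∫ ω, f (nextQueue (q ω) (a ω) (s ω)) ∂P = ∫ ω, f (q ω) ∂P := by
  rw [integral_comp_of_measurePreserving h.next, integral_comp_of_measurePreserving h.queue]

variable [IsProbabilityMeasure P]

lemma integrable_unusedService (h : IsStationarySlot P A π q s a) (f : Config n → ℝ) :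
    Integrable (fun ω => f (unusedService (q ω) (a ω) (s ω))) P :=
  (integrable_of_ae_mem_finite (μ := P.map fun ω => unusedService (q ω) (a ω) (s ω))
    (finite_setOf_forall_le 1) ((ae_map_iff h.measurable_unusedService.aemeasurable
      .of_discrete).2 h.ae_unusedService_le_one) f).comp_measurable h.measurable_unusedService

lemma integral_weight_unusedService (h : IsStationarySlot P A π q s a)
    (hA : ∀ i j, ∀ m, amax < m → A i j m = 0) (hπ : MemLp natVec 2 π) (p : Port n) :
    ∫ ω, (weight (portConfig p) (unusedService (q ω) (a ω) (s ω)) : ℝ) ∂P =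
      1 - portSum (arrivalMean A) p := by
  have hbalance : (fun ω => (weight (portConfig p) (unusedService (q ω) (a ω) (s ω)) : ℝ)) =ᵐ[P]
      fun ω => ⟪portVec p, natVec (nextQueue (q ω) (a ω) (s ω))⟫ - ⟪portVec p, natVec (q ω)⟫ +
        (1 - ⟪portVec p, natVec (a ω)⟫) := by
    filter_upwards [h.schedule_mem] with ω hs
    have hone : ⟪portVec p, natVec (s ω)⟫ = 1 := by
      rw [inner_portVec_natVec, mem_maximalSchedules_iff.1 hs p, Nat.cast_one]
    rw [← inner_portVec_natVec, natVec_nextQueue, inner_add_right, inner_add_right,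
      inner_sub_right, hone]
    ring
  have hq := ((h.memLp_queue hπ).const_inner (𝕜 := ℝ) (portVec p)).integrable one_le_two
  have hnext := ((h.memLp_next hπ).const_inner (𝕜 := ℝ) (portVec p)).integrable one_le_two
  have ha : Integrable (fun ω => ⟪portVec p, natVec (a ω)⟫) P :=
    h.arrivals.integrable_comp_of_integrable (integrable_arrival hA fun a => ⟪portVec p, natVec a⟫)
  rw [integral_congr_ae hbalance, integral_add (by fun_prop) (by fun_prop),
    integral_sub hnext hq, integral_sub (integrable_const 1) ha,
    h.integral_next fun x => ⟪portVec p, natVec x⟫,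
    integral_comp_of_measurePreserving h.arrivals fun x => ⟪portVec p, natVec x⟫,
    integral_inner_arrival hA, inner_portVec_vec]
  simp

lemma integral_norm_coveredPart_sq_le (h : IsStationarySlot P A π q s a)
    (hA : ∀ i j, ∀ m, amax < m → A i j m = 0) (hπ : MemLp natVec 2 π) (T : Set (Port n)) :
    ∫ ω, ‖coveredPart T (natVec (unusedService (q ω) (a ω) (s ω)))‖ ^ 2 ∂P ≤
      ∑ p, T.indicator (fun p => 1 - portSum (arrivalMean A) p) p := by
  have hint (p : Port n) : Integrable (fun ω => T.indicator (fun p =>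
      (weight (portConfig p) (unusedService (q ω) (a ω) (s ω)) : ℝ)) p) P :=
    h.integrable_unusedService fun u => T.indicator (fun p => (weight (portConfig p) u : ℝ)) p
  refine (integral_mono_ae
    (h.integrable_unusedService fun u => ‖coveredPart T (natVec u)‖ ^ 2)
    (integrable_finsetSum _ fun p _ => hint p)
    (h.ae_unusedService_le_one.mono fun ω hω => norm_coveredPart_sq_le T hω)).trans_eq ?_
  rw [integral_finsetSum _ fun p _ => hint p]
  refine Finset.sum_congr rfl fun p _ => ?_
  by_cases hp : p ∈ T
  · simp only [Set.indicator_of_mem hp, h.integral_weight_unusedService hA hπ]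
  · simp [hp]

lemma integrable_unusedServiceEffect (h : IsStationarySlot P A π q s a) (hπ : MemLp natVec 2 π)
    (T : Set (Port n)) :
    Integrable (fun ω => unusedServiceEffect T (q ω) (a ω) (s ω)) P := by
  have hmeas : Measurable fun ω => natVec (unusedService (q ω) (a ω) (s ω)) :=
    (Measurable.of_discrete (f := natVec)).comp h.measurable_unusedService
  have hu : MemLp (fun ω => natVec (unusedService (q ω) (a ω) (s ω))) 2 P :=
    (memLp_two_iff_integrable_sq_norm hmeas.aestronglyMeasurable).2
      (h.integrable_unusedService fun u => ‖natVec u‖ ^ 2)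
  have hnext : MemLp (fun ω => portProj T (natVec (nextQueue (q ω) (a ω) (s ω)))) 2 P :=
    (portProj T).comp_memLp' (h.memLp_next hπ)
  exact ((integrable_inner_of_memLp hnext hu).const_mul 2).sub
    (h.integrable_unusedService fun u => ‖portProj T (natVec u)‖ ^ 2)

lemma abs_integral_unusedServiceEffect_le (h : IsStationarySlot P A π q s a)
    (hA : ∀ i j, ∀ m, amax < m → A i j m = 0) (hπ : MemLp natVec 2 π)
    (hpolar : Integrable (fun q => ‖polarPart (portVec '' T) (natVec q)‖ ^ 2) π)
    {r : ℝ} (hr : 0 < r) :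
    |∫ ω, unusedServiceEffect T (q ω) (a ω) (s ω) ∂P| ≤
      r * ∫ q, ‖polarPart (portVec '' T) (natVec q)‖ ^ 2 ∂π +
        (1 + r⁻¹) * ∑ p, T.indicator (fun p => 1 - portSum (arrivalMean A) p) p := by
  have hnext : Integrable (fun ω =>
      r * ‖polarPart (portVec '' T) (natVec (nextQueue (q ω) (a ω) (s ω)))‖ ^ 2) P :=
    (h.next.integrable_comp_of_integrable hpolar).const_mul r
  have hcovered :=
    (h.integrable_unusedService fun u => ‖coveredPart T (natVec u)‖ ^ 2).const_mul (1 + r⁻¹)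
  calc |∫ ω, unusedServiceEffect T (q ω) (a ω) (s ω) ∂P|
      ≤ ∫ ω, |unusedServiceEffect T (q ω) (a ω) (s ω)| ∂P := abs_integral_le_integral_abs
    _ ≤ ∫ ω, (r * ‖polarPart (portVec '' T) (natVec (nextQueue (q ω) (a ω) (s ω)))‖ ^ 2 +
          (1 + r⁻¹) * ‖coveredPart T (natVec (unusedService (q ω) (a ω) (s ω)))‖ ^ 2) ∂P :=
        integral_mono (h.integrable_unusedServiceEffect hπ T).abs (hnext.add hcovered)
          fun ω => abs_unusedServiceEffect_le T _ _ _ hr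
    _ = r * ∫ q, ‖polarPart (portVec '' T) (natVec q)‖ ^ 2 ∂π + (1 + r⁻¹) *
          ∫ ω, ‖coveredPart T (natVec (unusedService (q ω) (a ω) (s ω)))‖ ^ 2 ∂P := by
        rw [integral_add hnext hcovered, integral_const_mul, integral_const_mul,
          integral_comp_of_measurePreserving h.next fun x =>
            ‖polarPart (portVec '' T) (natVec x)‖ ^ 2]
    _ ≤ _ := by
        gcongr
        exact h.integral_norm_coveredPart_sq_le hA hπ T

lemma integral_inner_arrivals_sub_mean (h : IsStationarySlot P A π q s a)
    (hA : ∀ i j, ∀ m, amax < m → A i j m = 0) (hπ : MemLp natVec 2 π) (L : Vec n →L[ℝ] Vec n)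
    (v : Vec n) : ∫ ω, ⟪L (natVec (q ω)) - v, natVec (a ω) - vec (arrivalMean A)⟫ ∂P = 0 := by
  have hindep : IndepFun (fun ω => L (natVec (q ω)) - v)
      (fun ω => natVec (a ω) - vec (arrivalMean A)) P :=
    h.indep.comp (φ := fun x => L (natVec x) - v)
      (ψ := fun x => natVec x - vec (arrivalMean A)) .of_discrete .of_discrete
  have ha : Integrable (fun ω => natVec (a ω) - vec (arrivalMean A)) P :=
    h.arrivals.integrable_comp_of_integrable
      (integrable_arrival hA fun a => natVec a - vec (arrivalMean A))
  have hmean : ∫ ω, (natVec (a ω) - vec (arrivalMean A)) ∂P = 0 := by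
    rw [integral_comp_of_measurePreserving h.arrivals fun x => natVec x - vec (arrivalMean A),
      integral_sub (integrable_arrival hA _) (integrable_const _), integral_natVec_arrival hA]
    simp
  have hq : Integrable (fun ω => L (natVec (q ω)) - v) P :=
    (L.integrable_comp ((h.memLp_queue hπ).integrable one_le_two)).sub (integrable_const v)
  have hbilin := hindep.integral_bilin hq ha (innerSL ℝ)
  rwa [hmean, map_zero] at hbilin

theorem two_mul_integral_inner_portProj (h : IsStationarySlot P A π q s a)
    (hA : ∀ i j, ∀ m, amax < m → A i j m = 0) (hπ : MemLp natVec 2 π) {k : RVec n} {ε : ℝ}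
    (hmean : ∀ p ∈ T, portSum (arrivalMean A) p = 1 - ε * portSum k p) :
    2 * ε * ∫ q, ⟪portProj T (natVec q), vec k⟫ ∂π =
      projVar T (arrivalVar A) + ε ^ 2 * ‖portProj T (vec k)‖ ^ 2 +
        ∫ ω, unusedServiceEffect T (q ω) (a ω) (s ω) ∂P := by
  let x (ω : Ω) := portProj T (natVec (q ω))
  let y (ω : Ω) := portProj T (natVec (nextQueue (q ω) (a ω) (s ω)))
  let w (ω : Ω) := natVec (a ω) - vec (arrivalMean A)
  have hx : MemLp x 2 P := (portProj T).comp_memLp' (h.memLp_queue hπ)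
  have hxsq : Integrable (fun ω => ‖x ω‖ ^ 2) P := hx.integrable_norm_pow two_ne_zero
  have hysq : Integrable (fun ω => ‖y ω‖ ^ 2) P :=
    ((portProj T).comp_memLp' (h.memLp_next hπ)).integrable_norm_pow two_ne_zero
  have hw : MemLp w 2 P :=
    ((memLp_two_iff_integrable_sq_norm (f := fun a => natVec a - vec (arrivalMean A))
      .of_discrete).2 (integrable_arrival hA _)).comp_measurePreserving h.arrivals
  have hwsq : Integrable (fun ω => ‖portProj T (w ω)‖ ^ 2) P :=
    ((portProj T).comp_memLp' hw).integrable_norm_pow two_ne_zero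
  have hcross : Integrable (fun ω => ⟪x ω - ε • portProj T (vec k), w ω⟫) P :=
    integrable_inner_of_memLp (hx.sub (memLp_const _)) hw
  have heffect := h.integrable_unusedServiceEffect hπ T
  have hidentity : (fun ω => 2 * ε * ⟪x ω, vec k⟫) =ᵐ[P] fun ω => ‖x ω‖ ^ 2 - ‖y ω‖ ^ 2 +
      ‖portProj T (w ω)‖ ^ 2 + ε ^ 2 * ‖portProj T (vec k)‖ ^ 2 +
      2 * ⟪x ω - ε • portProj T (vec k), w ω⟫ + unusedServiceEffect T (q ω) (a ω) (s ω) := by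
    filter_upwards [h.schedule_mem] with ω hs
    have := norm_portProj_nextQueue_sq hmean (q := q ω) (a := a ω) hs
    dsimp only [x, y, w]
    linarith
  rw [← integral_comp_of_measurePreserving h.queue fun x => ⟪portProj T (natVec x), vec k⟫,
    ← integral_const_mul, integral_congr_ae hidentity, integral_add (by fun_prop) heffect,
    integral_add (by fun_prop) (by fun_prop), integral_add (by fun_prop) (by fun_prop),
    integral_add (by fun_prop) hwsq, integral_sub hxsq hysq, integral_const_mul 2,
    h.integral_inner_arrivals_sub_mean hA hπ,
    h.integral_next fun x => ‖portProj T (natVec x)‖ ^ 2,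
    integral_comp_of_measurePreserving h.arrivals
      fun a => ‖portProj T (natVec a - vec (arrivalMean A))‖ ^ 2,
    integral_norm_map_arrival_sub_sq hA]
  simp [x, projVar]

end IsStationarySlot

end StationarySlot

section HeavyTraffic

lemma IsStationarySlot.abs_two_mul_integral_inner_portProj_sub_le {Ω : Type*} [MeasurableSpace Ω]
    {P : Measure Ω} [IsProbabilityMeasure P] {A : Fin n → Fin n → PMF ℕ} {π : Measure (Config n)}
    {q s a : Ω → Config n} (h : IsStationarySlot P A π q s a) {amax : ℕ}
    (hA : ∀ i j, ∀ m, amax < m → A i j m = 0) (hπ : MemLp natVec 2 π) {T : Set (Port n)}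
    {k : RVec n} {ε : ℝ} (hmean : ∀ p ∈ T, portSum (arrivalMean A) p = 1 - ε * portSum k p)
    (hpolar : Integrable (fun q => ‖polarPart (portVec '' T) (natVec q)‖ ^ 2) π)
    {r : ℝ} (hr : 0 < r) :
    |2 * ε * ∫ q, ⟪portProj T (natVec q), vec k⟫ ∂π - projVar T (arrivalVar A)| ≤
      ε ^ 2 * ‖vec k‖ ^ 2 + (r * ∫ q, ‖polarPart (portVec '' T) (natVec q)‖ ^ 2 ∂π +
        (1 + r⁻¹) * (ε * ∑ p, T.indicator (portSum k) p)) := by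
  have hproj : ‖portProj T (vec k)‖ ^ 2 ≤ ‖vec k‖ ^ 2 := by
    gcongr
    exact norm_portProj_le T _
  have hslack : ∑ p, T.indicator (fun p => 1 - portSum (arrivalMean A) p) p =
      ε * ∑ p, T.indicator (portSum k) p := by
    rw [Finset.mul_sum]
    refine Finset.sum_congr rfl fun p _ => ?_
    by_cases hp : p ∈ T
    · simp [hp, hmean p hp]
    · simp [hp]
  rw [h.two_mul_integral_inner_portProj hA hπ hmean, add_assoc, add_sub_cancel_left,
    ← hslack]
  refine (abs_add_le _ _).trans
    (add_le_add ?_ (h.abs_integral_unusedServiceEffect_le hA hπ hpolar hr))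
  rw [abs_of_nonneg (by positivity)]
  exact mul_le_mul_of_nonneg_left hproj (sq_nonneg ε)

/-- A family of switches, indexed by `ε ∈ (0, ε₀)`, that approaches heavy traffic: the arrival
rates `ν - ε • k` tend to a vector `ν` of positive rates which saturates exactly the ports in `T`,
while the arrivals stay bounded by `amax` and their variances tend to `τ`. -/
structure IsHeavyTraffic (T : Set (Port n)) (A : ℝ → Fin n → Fin n → PMF ℕ) (amax : ℕ) (ε₀ : ℝ)
    (ν k τ : RVec n) : Prop where
  rate_pos : ∀ i j, 0 < ν i j
  portSum_rate_eq_one : ∀ p ∈ T, portSum ν p = 1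
  portSum_rate_lt_one : ∀ p ∉ T, portSum ν p < 1
  direction_nonneg : ∀ i j, 0 ≤ k i j
  portSum_direction_pos : ∀ p ∈ T, 0 < portSum k p
  pos : 0 < ε₀
  bounded : ∀ ε ∈ Set.Ioo 0 ε₀, ∀ i j, ∀ m, amax < m → A ε i j m = 0
  mean : ∀ ε ∈ Set.Ioo 0 ε₀, arrivalMean (A ε) = ν - ε • k
  tendsto_var : Tendsto (fun ε => arrivalVar (A ε)) (𝓝[>] 0) (𝓝 τ)

lemma memLp_polarPart {π : Measure (Config n)} (hπ : MemLp natVec 2 π) (s : Set (Vec n)) :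
    MemLp (fun q => polarPart s (natVec q)) 2 π :=
  hπ.mono .of_discrete (ae_of_all _ fun _ => norm_polarPart_le _ _)

lemma memLp_conePart {π : Measure (Config n)} (hπ : MemLp natVec 2 π) (s : Set (Vec n)) :
    MemLp (fun q => conePart s (natVec q)) 2 π :=
  hπ.sub (memLp_polarPart hπ s)

lemma meanTotal_eq_ofReal_integral {π : Measure (Config n)} [IsFiniteMeasure π]
    (hπ : MemLp natVec 2 π) : meanTotal π = ENNReal.ofReal (∫ q, ⟪natVec q, vec 1⟫ ∂π) := by
  have htotal (q : Config n) : ⟪natVec q, vec 1⟫ = ((∑ i, ∑ j, q i j : ℕ) : ℝ) := by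
    rw [inner_natVec_one]
    push_cast
    rfl
  have hint : Integrable (fun q => ⟪natVec q, vec 1⟫) π :=
    integrable_inner_of_memLp hπ (memLp_const _)
  simp only [htotal] at hint ⊢
  rw [ofReal_integral_eq_lintegral_ofReal hint (ae_of_all _ fun _ => Nat.cast_nonneg _), meanTotal]
  simp only [ENNReal.ofReal_natCast]

lemma integrable_inner_conePart_add_inner_polarPart {π : Measure (Config n)} [IsFiniteMeasure π]
    (hπ : MemLp natVec 2 π) (s : Set (Vec n)) (u v : Vec n) :
    Integrable (fun q => ⟪conePart s (natVec q), u⟫ + ⟪polarPart s (natVec q), v⟫) π :=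
  (integrable_inner_of_memLp (memLp_conePart hπ s) (memLp_const u)).add
    (integrable_inner_of_memLp (memLp_polarPart hπ s) (memLp_const v))

lemma inner_natVec_one_le {T : Set (Port n)} {k : RVec n} {κ : ℝ} (hκ : 0 < κ)
    (hle : ∀ p ∈ T, κ ≤ portSum k p) (q : Config n) :
    ⟪natVec q, vec 1⟫ ≤ ⟪conePart (portVec '' T) (natVec q), (n / κ) • vec k⟫ +
      ⟪polarPart (portVec '' T) (natVec q), vec 1⟫ := by
  nth_rewrite 1 [← conePart_add_polarPart (portVec '' T) (natVec q), inner_add_left, ← map_smul]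
  gcongr
  refine inner_conePart_vec_le (fun p hp => ?_) _
  rw [portSum_one, portSum_smul, div_mul_eq_mul_div, le_div_iff₀ hκ]
  exact mul_le_mul_of_nonneg_left (hle p hp) n.cast_nonneg

lemma le_inner_natVec_one {T : Set (Port n)} {k : RVec n} {κ : ℝ} (hκ : 0 < κ)
    (hle : ∀ p ∈ T, portSum k p ≤ κ) (q : Config n) :
    ⟪conePart (portVec '' T) (natVec q), (n / κ) • vec k⟫ +
      ⟪polarPart (portVec '' T) (natVec q), vec 1⟫ ≤ ⟪natVec q, vec 1⟫ := by
  nth_rewrite 3 [← conePart_add_polarPart (portVec '' T) (natVec q)]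
  rw [inner_add_left, ← map_smul]
  gcongr
  refine inner_conePart_vec_le (fun p hp => ?_) _
  rw [portSum_one, portSum_smul, div_mul_eq_mul_div, div_le_iff₀ hκ]
  exact mul_le_mul_of_nonneg_left (hle p hp) n.cast_nonneg

namespace IsHeavyTraffic

variable {T : Set (Port n)} {A : ℝ → Fin n → Fin n → PMF ℕ} {amax : ℕ} {ε₀ : ℝ} {ν k τ : RVec n}
  {pol : ℝ → Policy n} {π : ℝ → Measure (Config n)}

lemma rate_mem_capacityRegion (h : IsHeavyTraffic T A amax ε₀ ν k τ) : ν ∈ capacityRegion n := by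
  refine mem_capacityRegion_iff.2 ⟨fun i j => (h.rate_pos i j).le, fun p => ?_⟩
  by_cases hp : p ∈ T
  · exact (h.portSum_rate_eq_one p hp).le
  · exact (h.portSum_rate_lt_one p hp).le

lemma portSum_arrivalMean (h : IsHeavyTraffic T A amax ε₀ ν k τ) {ε : ℝ} (hε : ε ∈ Set.Ioo 0 ε₀)
    (p : Port n) : portSum (arrivalMean (A ε)) p = portSum ν p - ε * portSum k p := by
  rw [h.mean ε hε, sub_eq_add_neg, ← neg_smul, portSum_add_smul, neg_mul, ← sub_eq_add_neg]

lemma portSum_arrivalMean_lt_one (h : IsHeavyTraffic T A amax ε₀ ν k τ) {ε : ℝ}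
    (hε : ε ∈ Set.Ioo 0 ε₀) (p : Port n) : portSum (arrivalMean (A ε)) p < 1 := by
  rw [h.portSum_arrivalMean hε]
  by_cases hp : p ∈ T
  · linarith [h.portSum_rate_eq_one p hp, mul_pos hε.1 (h.portSum_direction_pos p hp)]
  · have hk : 0 ≤ portSum k p := portSum_nonneg h.direction_nonneg p
    linarith [h.portSum_rate_lt_one p hp, mul_nonneg hε.1.le hk]

lemma arrivalMean_pos (h : IsHeavyTraffic T A amax ε₀ ν k τ) {ε : ℝ} (hε : ε ∈ Set.Ioo 0 ε₀)
    (i j : Fin n) : 0 < arrivalMean (A ε) i j := by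
  obtain ⟨ε', hlt, hε'⟩ := exists_between hε.2
  have hmean' : 0 ≤ arrivalMean (A ε') i j := integral_nonneg fun m => m.cast_nonneg
  rw [h.mean ε' ⟨hε.1.trans hlt, hε'⟩] at hmean'
  rw [h.mean ε hε]
  simp only [Pi.sub_apply, Pi.smul_apply, smul_eq_mul] at hmean' ⊢
  rcases (h.direction_nonneg i j).eq_or_lt with hk | hk
  · simpa [← hk] using h.rate_pos i j
  · linarith [mul_lt_mul_of_pos_right hlt hk]

lemma exists_hasConeDrift_empty (h : IsHeavyTraffic T A amax ε₀ ν k τ) {ε : ℝ}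
    (hε : ε ∈ Set.Ioo 0 ε₀) {pol : Policy n} (hpol : pol.IsMaxWeight) :
    ∃ η > 0, HasConeDrift ∅ pol (arrivalMean (A ε)) η := by
  have hlt := h.portSum_arrivalMean_lt_one hε
  have hmem : arrivalMean (A ε) ∈ capacityRegion n :=
    mem_capacityRegion_iff.2 ⟨fun i j => (h.arrivalMean_pos hε i j).le, fun p => (hlt p).le⟩
  obtain ⟨δ, hδ, hslack⟩ := exists_add_smul_mem_capacityRegion (T := ∅) (h.arrivalMean_pos hε) hmem
    fun p _ => hlt p
  exact ⟨δ, hδ, by simpa using hpol.hasConeDrift (by simp) hslack (k := 0) le_rfl⟩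

lemma existsUnique_isSteadyState (h : IsHeavyTraffic T A amax ε₀ ν k τ) {ε : ℝ}
    (hε : ε ∈ Set.Ioo 0 ε₀) {pol : Policy n} (hpol : pol.IsMaxWeight) :
    ∃! π, IsSteadyState (queueKernel (A ε) pol) π := by
  obtain ⟨η, hη, hdrift⟩ := h.exists_hasConeDrift_empty hε hpol
  refine hpol.existsUnique_isSteadyState (h.bounded ε hε) hη hdrift fun i j => ?_
  calc arrivalMean (A ε) i j ≤ portSum (arrivalMean (A ε)) (.inl i) :=
        Finset.single_le_sum (f := arrivalMean (A ε) i)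
          (fun j _ => (h.arrivalMean_pos hε i j).le) (Finset.mem_univ j)
    _ < 1 := h.portSum_arrivalMean_lt_one hε _

lemma memLp_natVec (h : IsHeavyTraffic T A amax ε₀ ν k τ) {ε : ℝ} (hε : ε ∈ Set.Ioo 0 ε₀)
    {pol : Policy n} (hpol : pol.IsMaxWeight) {π : Measure (Config n)}
    (hπ : IsSteadyState (queueKernel (A ε) pol) π) : MemLp natVec 2 π := by
  obtain ⟨η, hη, hdrift⟩ := h.exists_hasConeDrift_empty hε hpol
  rw [memLp_two_iff_integrable_sq_norm (f := natVec) .of_discrete]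
  simpa [polarPart_empty] using hdrift.integrable_norm_polarPart_sq (h.bounded ε hε) hη hπ

/-- State space collapse; the queue lengths themselves grow like `1 / ε`. -/
lemma exists_eventually_integral_norm_polarPart_sq_le (h : IsHeavyTraffic T A amax ε₀ ν k τ)
    (hpol : ∀ ε ∈ Set.Ioo 0 ε₀, (pol ε).IsMaxWeight)
    (hπ : ∀ ε ∈ Set.Ioo 0 ε₀, IsSteadyState (queueKernel (A ε) (pol ε)) (π ε)) :
    ∃ M, ∀ᶠ ε in 𝓝[>] 0,
      Integrable (fun q => ‖polarPart (portVec '' T) (natVec q)‖ ^ 2) (π ε) ∧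
        ∫ q, ‖polarPart (portVec '' T) (natVec q)‖ ^ 2 ∂π ε ≤ M := by
  obtain ⟨δ, hδ, hslack⟩ := exists_add_smul_mem_capacityRegion h.rate_pos h.rate_mem_capacityRegion
    h.portSum_rate_lt_one
  have hsmall : ∀ᶠ ε in 𝓝[>] (0 : ℝ), ε * ‖vec k‖ < δ / 2 := by
    refine nhdsWithin_le_nhds (Tendsto.eventually_lt_const (half_pos hδ) ?_)
    exact (continuous_mul_const ‖vec k‖).tendsto' 0 0 (zero_mul _)
  refine ⟨driftConst (n * (amax + 1)) (δ / 2) / (2 * (δ / 2)), ?_⟩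
  filter_upwards [Ioo_mem_nhdsGT h.pos, hsmall] with ε hε hεδ
  have hdrift : HasConeDrift T (pol ε) (arrivalMean (A ε)) (δ / 2) := by
    rw [h.mean ε hε]
    exact ((hpol ε hε).hasConeDrift h.portSum_rate_eq_one hslack hε.1.le).anti (by linarith)
  exact ⟨hdrift.integrable_norm_polarPart_sq (h.bounded ε hε) (half_pos hδ) (hπ ε hε),
    hdrift.integral_norm_polarPart_sq_le (h.bounded ε hε) (half_pos hδ) (hπ ε hε)⟩

lemma tendsto_mul_integral_inner_portProj (h : IsHeavyTraffic T A amax ε₀ ν k τ)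
    (hpol : ∀ ε ∈ Set.Ioo 0 ε₀, (pol ε).IsMaxWeight)
    (hπ : ∀ ε ∈ Set.Ioo 0 ε₀, IsSteadyState (queueKernel (A ε) (pol ε)) (π ε)) :
    Tendsto (fun ε => ε * ∫ q, ⟪portProj T (natVec q), vec k⟫ ∂π ε) (𝓝[>] 0)
      (𝓝 (projVar T τ / 2)) := by
  obtain ⟨M, hM⟩ := h.exists_eventually_integral_norm_polarPart_sq_le hpol hπ
  let error (ε : ℝ) : ℝ := ε ^ 2 * ‖vec k‖ ^ 2 + (√ε * M +
    (ε + √ε) * ∑ p, T.indicator (portSum k) p)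
  have herror : Tendsto error (𝓝[>] 0) (𝓝 0) :=
    (Continuous.tendsto' (by fun_prop) 0 0 (by simp [error])).mono_left nhdsWithin_le_nhds
  have hsub : Tendsto (fun ε => 2 * ε * ∫ q, ⟪portProj T (natVec q), vec k⟫ ∂π ε -
      projVar T (arrivalVar (A ε))) (𝓝[>] 0) (𝓝 0) := by
    refine squeeze_zero_norm' ?_ herror
    filter_upwards [Ioo_mem_nhdsGT h.pos, hM] with ε hε ⟨hint, hle⟩
    have := (hπ ε hε).1
    have hslot := (hπ ε hε).isStationarySlot fun q s hs => (hpol ε hε q s hs).1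
    have hmean (p : Port n) (hp : p ∈ T) :
        portSum (arrivalMean (A ε)) p = 1 - ε * portSum k p := by
      rw [h.portSum_arrivalMean hε, h.portSum_rate_eq_one p hp]
    refine (hslot.abs_two_mul_integral_inner_portProj_sub_le (h.bounded ε hε)
      (h.memLp_natVec hε (hpol ε hε) (hπ ε hε)) hmean hint (Real.sqrt_pos.2 hε.1)).trans ?_
    have hsqrt : (1 + (√ε)⁻¹) * ε = ε + √ε := by
      rw [one_add_mul, inv_mul_eq_div, Real.div_sqrt]
    rw [← mul_assoc, hsqrt]
    dsimp only [error]
    gcongr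
  have hvar := ((continuous_projVar T).tendsto τ).comp h.tendsto_var
  convert (hsub.add hvar).div_const 2 using 2 with ε
  · simp only [Function.comp_apply]
    ring
  · rw [zero_add]

lemma tendsto_mul_integral_of_abs_le_norm_polarPart (h : IsHeavyTraffic T A amax ε₀ ν k τ)
    (hpol : ∀ ε ∈ Set.Ioo 0 ε₀, (pol ε).IsMaxWeight)
    (hπ : ∀ ε ∈ Set.Ioo 0 ε₀, IsSteadyState (queueKernel (A ε) (pol ε)) (π ε))
    {f : Config n → ℝ} {C : ℝ}
    (hf : ∀ q, |f q| ≤ C * ‖polarPart (portVec '' T) (natVec q)‖) :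
    Tendsto (fun ε => ε * ∫ q, f q ∂π ε) (𝓝[>] 0) (𝓝 0) := by
  obtain ⟨M, hM⟩ := h.exists_eventually_integral_norm_polarPart_sq_le hpol hπ
  have hbound : Tendsto (fun ε : ℝ => ε * (|C| * (1 + M))) (𝓝[>] 0) (𝓝 0) :=
    ((continuous_mul_const _).tendsto' 0 0 (zero_mul _)).mono_left nhdsWithin_le_nhds
  refine squeeze_zero_norm' ?_ hbound
  filter_upwards [Ioo_mem_nhdsGT h.pos, hM] with ε hε ⟨hint, hle⟩
  have := (hπ ε hε).1
  rw [norm_mul, Real.norm_of_nonneg hε.1.le]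
  refine mul_le_mul_of_nonneg_left ?_ hε.1.le
  calc ‖∫ q, f q ∂π ε‖
      ≤ ∫ q, |C| * (1 + ‖polarPart (portVec '' T) (natVec q)‖ ^ 2) ∂π ε := by
        refine norm_integral_le_of_norm_le (((integrable_const 1).add hint).const_mul _)
          (ae_of_all _ fun q => (hf q).trans ?_)
        refine mul_le_mul (le_abs_self C) ?_ (norm_nonneg _) (abs_nonneg C)
        nlinarith [sq_nonneg (‖polarPart (portVec '' T) (natVec q)‖ - 1)]
    _ = |C| * (1 + ∫ q, ‖polarPart (portVec '' T) (natVec q)‖ ^ 2 ∂π ε) := by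
        rw [integral_const_mul, integral_add (integrable_const 1) hint, integral_const,
          probReal_univ, one_smul]
    _ ≤ |C| * (1 + M) := by gcongr

lemma tendsto_mul_integral_inner_conePart_add (h : IsHeavyTraffic T A amax ε₀ ν k τ)
    (hpol : ∀ ε ∈ Set.Ioo 0 ε₀, (pol ε).IsMaxWeight)
    (hπ : ∀ ε ∈ Set.Ioo 0 ε₀, IsSteadyState (queueKernel (A ε) (pol ε)) (π ε)) (c : ℝ)
    (v : Vec n) :
    Tendsto (fun ε => ε * ∫ q, (⟪conePart (portVec '' T) (natVec q), c • vec k⟫ +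
      ⟪polarPart (portVec '' T) (natVec q), v⟫) ∂π ε) (𝓝[>] 0) (𝓝 (c * (projVar T τ / 2))) := by
  let error (q : Config n) : ℝ := ⟪polarPart (portVec '' T) (natVec q), v⟫ -
    ⟪portProj T (natVec q) - conePart (portVec '' T) (natVec q), c • vec k⟫
  have herror := h.tendsto_mul_integral_of_abs_le_norm_polarPart hpol hπ (f := error)
    (C := ‖v‖ + ‖c • vec k‖) fun q => by
      refine (abs_sub _ _).trans ?_
      rw [add_mul, mul_comm ‖v‖, mul_comm ‖c • vec k‖]
      refine add_le_add (abs_real_inner_le_norm _ _) ((abs_real_inner_le_norm _ _).trans ?_)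
      gcongr
      exact norm_starProjection_span_sub_conePart_le _ _
  have hlim := ((h.tendsto_mul_integral_inner_portProj hpol hπ).const_mul c).add herror
  rw [add_zero] at hlim
  refine hlim.congr' ?_
  filter_upwards [Ioo_mem_nhdsGT h.pos] with ε hε
  have := (hπ ε hε).1
  have hπ₂ := h.memLp_natVec hε (hpol ε hε) (hπ ε hε)
  have hproj : Integrable (fun q => ⟪portProj T (natVec q), vec k⟫) (π ε) :=
    integrable_inner_of_memLp ((portProj T).comp_memLp' hπ₂) (memLp_const _)
  have herr : Integrable error (π ε) :=
    (integrable_inner_of_memLp (memLp_polarPart hπ₂ _) (memLp_const _)).sub <|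
      integrable_inner_of_memLp (((portProj T).comp_memLp' hπ₂).sub (memLp_conePart hπ₂ _))
        (memLp_const _)
  rw [mul_left_comm, ← mul_add, ← integral_const_mul, ← integral_add (hproj.const_mul c) herr]
  congr 2 with q
  simp only [error, inner_sub_left, real_inner_smul_right]
  ring

theorem limsup_meanTotal_le (h : IsHeavyTraffic T A amax ε₀ ν k τ)
    (hpol : ∀ ε ∈ Set.Ioo 0 ε₀, (pol ε).IsMaxWeight)
    (hπ : ∀ ε ∈ Set.Ioo 0 ε₀, IsSteadyState (queueKernel (A ε) (pol ε)) (π ε)) {κ : ℝ}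
    (hκ : 0 < κ) (hle : ∀ p ∈ T, κ ≤ portSum k p) :
    limsup (fun ε => ENNReal.ofReal ε * meanTotal (π ε)) (𝓝[>] 0) ≤
      ENNReal.ofReal (n * projVar T τ / (2 * κ)) := by
  have hlim := (ENNReal.continuous_ofReal.tendsto _).comp
    (h.tendsto_mul_integral_inner_conePart_add hpol hπ (n / κ) (vec 1))
  rw [show n * projVar T τ / (2 * κ) = n / κ * (projVar T τ / 2) by ring, ← hlim.limsup_eq]
  refine limsup_le_limsup ?_
  filter_upwards [Ioo_mem_nhdsGT h.pos] with ε hε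
  have := (hπ ε hε).1
  have hπ₂ := h.memLp_natVec hε (hpol ε hε) (hπ ε hε)
  rw [meanTotal_eq_ofReal_integral hπ₂, ← ENNReal.ofReal_mul hε.1.le]
  refine ENNReal.ofReal_le_ofReal (mul_le_mul_of_nonneg_left ?_ hε.1.le)
  exact integral_mono (integrable_inner_of_memLp hπ₂ (memLp_const _))
    (integrable_inner_conePart_add_inner_polarPart hπ₂ _ _ _) (inner_natVec_one_le hκ hle)

theorem le_liminf_meanTotal (h : IsHeavyTraffic T A amax ε₀ ν k τ)
    (hpol : ∀ ε ∈ Set.Ioo 0 ε₀, (pol ε).IsMaxWeight)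
    (hπ : ∀ ε ∈ Set.Ioo 0 ε₀, IsSteadyState (queueKernel (A ε) (pol ε)) (π ε)) {κ : ℝ}
    (hκ : 0 < κ) (hle : ∀ p ∈ T, portSum k p ≤ κ) :
    ENNReal.ofReal (n * projVar T τ / (2 * κ)) ≤
      liminf (fun ε => ENNReal.ofReal ε * meanTotal (π ε)) (𝓝[>] 0) := by
  have hlim := (ENNReal.continuous_ofReal.tendsto _).comp
    (h.tendsto_mul_integral_inner_conePart_add hpol hπ (n / κ) (vec 1))
  rw [show n * projVar T τ / (2 * κ) = n / κ * (projVar T τ / 2) by ring, ← hlim.liminf_eq]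
  refine liminf_le_liminf ?_
  filter_upwards [Ioo_mem_nhdsGT h.pos] with ε hε
  have := (hπ ε hε).1
  have hπ₂ := h.memLp_natVec hε (hpol ε hε) (hπ ε hε)
  rw [meanTotal_eq_ofReal_integral hπ₂, ← ENNReal.ofReal_mul hε.1.le]
  refine ENNReal.ofReal_le_ofReal (mul_le_mul_of_nonneg_left ?_ hε.1.le)
  exact integral_mono (integrable_inner_conePart_add_inner_polarPart hπ₂ _ _ _)
    (integrable_inner_of_memLp hπ₂ (memLp_const _)) (le_inner_natVec_one hκ hle)

theorem limsup_meanTotal_le_kappaMin {n₁ n₂ : ℕ}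
    (h : IsHeavyTraffic (saturated n n₁ n₂) A amax ε₀ ν k τ)
    (hpol : ∀ ε ∈ Set.Ioo 0 ε₀, (pol ε).IsMaxWeight)
    (hπ : ∀ ε ∈ Set.Ioo 0 ε₀, IsSteadyState (queueKernel (A ε) (pol ε)) (π ε)) :
    limsup (fun ε => ENNReal.ofReal ε * meanTotal (π ε)) (𝓝[>] 0) ≤
      ENNReal.ofReal (n * projVar (saturated n n₁ n₂) τ / (2 * kappaMin n₁ n₂ k)) := by
  rcases (saturated n n₁ n₂).eq_empty_or_nonempty with hT | hT
  · have hle := h.limsup_meanTotal_le hpol hπ one_pos (by simp [hT])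
    simpa [hT, projVar_empty] using hle
  · obtain ⟨p, hp, hmin⟩ := exists_portSum_eq_kappaMin k hT
    exact h.limsup_meanTotal_le hpol hπ (hmin ▸ h.portSum_direction_pos p hp)
      fun p hp => kappaMin_le_portSum k hp

theorem kappaMax_le_liminf_meanTotal {n₁ n₂ : ℕ}
    (h : IsHeavyTraffic (saturated n n₁ n₂) A amax ε₀ ν k τ)
    (hpol : ∀ ε ∈ Set.Ioo 0 ε₀, (pol ε).IsMaxWeight)
    (hπ : ∀ ε ∈ Set.Ioo 0 ε₀, IsSteadyState (queueKernel (A ε) (pol ε)) (π ε)) :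
    ENNReal.ofReal (n * projVar (saturated n n₁ n₂) τ / (2 * kappaMax n₁ n₂ k)) ≤
      liminf (fun ε => ENNReal.ofReal ε * meanTotal (π ε)) (𝓝[>] 0) := by
  rcases (saturated n n₁ n₂).eq_empty_or_nonempty with hT | hT
  · simp [hT, projVar_empty]
  · obtain ⟨p, hp, hmax⟩ := exists_portSum_eq_kappaMax k hT
    exact h.le_liminf_meanTotal hpol hπ (hmax ▸ h.portSum_direction_pos p hp)
      fun p hp => portSum_le_kappaMax k hp

end IsHeavyTraffic

end HeavyTraffic

end Switch

theorem mainTheorem5 (n n₁ n₂ : ℕ) (hn₁ : n₁ < n) (hn₂ : n₂ < n)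
    (ν : Switch.RVec n) (hν : ν ∈ intrinsicInterior ℝ (Switch.face n n₁ n₂))
    (hν_pos : ∀ i j, 0 < ν i j)
    (k : Switch.RVec n) (hk_nonneg : ∀ i j, 0 ≤ k i j)
    (hk_norm : ∑ i, ∑ j, k i j = (n : ℝ))
    (hk_row : ∀ i : Fin n, (i : ℕ) < n₁ → 0 < Switch.rowSum k i)
    (hk_col : ∀ j : Fin n, (j : ℕ) < n₂ → 0 < Switch.colSum k j)
    (ε₀ : ℝ) (hε₀ : 0 < ε₀)
    (A : ℝ → Fin n → Fin n → PMF ℕ) (amax : ℕ)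
    (hA_bdd : ∀ ε ∈ Set.Ioo 0 ε₀, ∀ i j, ∀ m, amax < m → A ε i j m = 0)
    (hA_mean : ∀ ε ∈ Set.Ioo 0 ε₀, ∀ i j,
      ∫ m : ℕ, (m : ℝ) ∂(A ε i j).toMeasure = ν i j - ε * k i j)
    (σ : Switch.RVec n)
    (hA_var : ∀ i j, Tendsto (fun ε => variance (fun m : ℕ => (m : ℝ)) (A ε i j).toMeasure)
      (𝓝[>] 0) (𝓝 (σ i j ^ 2))) :
    -- the switches operating under MaxWeight
    (∀ pol : ℝ → Switch.Policy n, (∀ ε ∈ Set.Ioo 0 ε₀, (pol ε).IsMaxWeight) →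
      (∀ ε ∈ Set.Ioo 0 ε₀,
        ∃! π : Measure (Switch.Config n),
          Switch.IsSteadyState (Switch.queueKernel (A ε) (pol ε)) π) ∧
      ∀ π : ℝ → Measure (Switch.Config n),
        (∀ ε ∈ Set.Ioo 0 ε₀,
          Switch.IsSteadyState (Switch.queueKernel (A ε) (pol ε)) (π ε)) →
        ENNReal.ofReal (Switch.dot (fun i j => σ i j ^ 2) (Switch.zeta n n₁ n₂)
              / (2 * Switch.kappaMax n₁ n₂ k))
            ≤ liminf (fun ε => ENNReal.ofReal ε * Switch.meanTotal (π ε)) (𝓝[>] 0) ∧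
          limsup (fun ε => ENNReal.ofReal ε * Switch.meanTotal (π ε)) (𝓝[>] 0)
            ≤ ENNReal.ofReal (Switch.dot (fun i j => σ i j ^ 2) (Switch.zeta n n₁ n₂)
              / (2 * Switch.kappaMin n₁ n₂ k))) ∧
    -- the same switches operating under arbitrary stable scheduling policies
    (∀ (Ω : ℝ → Type*) [mΩ : ∀ ε, MeasurableSpace (Ω ε)] (P : ∀ ε, Measure (Ω ε))
        [∀ ε, IsProbabilityMeasure (P ε)] (ℱ : ∀ ε, Filtration ℕ (mΩ ε))
        (a s q : ∀ ε, ℕ → Ω ε → Switch.Config n)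
        (π : ℝ → Measure (Switch.Config n)) [∀ ε, IsProbabilityMeasure (π ε)],
      (∀ ε ∈ Set.Ioo 0 ε₀,
        Switch.IsSwitchProcess (P ε) (A ε) (ℱ ε) (a ε) (s ε) (q ε) ∧
        TendstoInDistribution (q ε) atTop id (fun _ => P ε) (π ε)) →
      ENNReal.ofReal (1 / 2 * max
          (Switch.dot (fun i j => σ i j ^ 2) (Switch.zetaRow n₁ k))
          (Switch.dot (fun i j => σ i j ^ 2) (Switch.zetaCol n₂ k)))
        ≤ liminf (fun ε => ENNReal.ofReal ε * Switch.meanTotal (π ε)) (𝓝[>] 0)) := by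
  have hface := Switch.mem_face_iff.1 (intrinsicInterior_subset hν)
  have h : Switch.IsHeavyTraffic (Switch.saturated n n₁ n₂) A amax ε₀ ν k (fun i j => σ i j ^ 2) :=
    { rate_pos := hν_pos
      portSum_rate_eq_one := hface.2
      portSum_rate_lt_one := fun p hp =>
        Switch.portSum_lt_one_of_mem_intrinsicInterior_face hn₁ hn₂ hν hp
      direction_nonneg := hk_nonneg
      portSum_direction_pos := by rintro (i | j) hp; exacts [hk_row i hp, hk_col j hp]
      pos := hε₀
      bounded := hA_bdd
      mean := fun ε hε => funext fun i => funext fun j => hA_mean ε hε i j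
      tendsto_var := tendsto_pi_nhds.2 fun i => tendsto_pi_nhds.2 (hA_var i) }
  simp only [← Switch.mul_projVar_saturated hn₁ hn₂]
  exact ⟨fun pol hpol => ⟨fun ε hε => h.existsUnique_isSteadyState hε (hpol ε hε),
      fun π hπ => ⟨h.kappaMax_le_liminf_meanTotal hpol hπ, h.limsup_meanTotal_le_kappaMin hpol hπ⟩⟩,
    fun Ω _ P _ ℱ a s q π _ hP => Switch.ofReal_half_max_le_liminf_meanTotal
      h.portSum_rate_eq_one h.portSum_direction_pos hε₀ h.bounded h.mean h.tendsto_var hP⟩
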